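/- Let $d\ge 1$, let $D\subset\mathbb{R}^d$ be a bounded convex domain (non-empty, open), let $S\subset\mathbb{R}^d$ be the unit sphere with its surface measure $ds$, and let $\sigma:D\times S\to\mathbb{R}$ be measurable with $0\le\sigma\le\sigma_{\max}<\infty$ almost everywhere. Let $n(x)$ be the outward unit normal, defined at almost every $x\in\partial D$, and put $$\Gamma_-(s)=\{x\in\partial D : s\cdot n(x)<0\},\qquad \Gamma_-=\{(x,s)\in\partial D\times S : s\cdot n(x)<0\}.$$ For $s\in S$ let $H(s;D)=\{v\in L_2(D) : s\cdot\nabla v\in L_2(D)\}$ (weak derivative) with norm $\|v\|_{H(s;D)}^2=\|v\|_{L_2(D)}^2+\|s\cdot\nabla v\|_{L_2(D)}^2$, and let $H(D\times S)=\{v\in L_2(D\times S) : s\cdot\nabla_x v\in L_2(D\times S)\}$ with norm $\|v\|_{H(D\times S)}^2=\|v\|_{L_2(D\times S)}^2+\|s\cdot\nabla_x v\|_{L_2(D\times S)}^2$. Let $H_{0,\Gamma_-(s)}(s;D)$ be the closure in $H(s;D)$ of $\{v\in C^1(\overline D) : v|_{\Gamma_-(s)}=0\}$ and $H_{0,-}(D\times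 S)$ the closure in $H(D\times S)$ of $\{v\in C^1(\overline{D}\times S) : v|_{\Gamma_-}=0\}$. Put $$a(u,v;s)=\int_D\bigl(s\cdot\nabla u+\sigma(\cdot,s)u\bigr)v\,dx,\qquad a(u,v)=\int_S a(u(\cdot,s),v(\cdot,s);s)\,ds .$$ Then there is a constant $C$, independent of $s$ and of the data, such that: (i) for every $s\in S$ for which $\sigma(\cdot,s)$ is measurable with $0\le\sigma(\cdot,s)\le\sigma_{\max}$ a.e. in $D$ (this holds for almost every $s\in S$, and for every $s$ if $\sigma$ is Borel measurable with $0\le\sigma\le\sigma_{\max}$ everywhere) and every $f\in L_2(D)$ there is exactly one $u\in H_{0,\Gamma_-(s)}(s;D)$ with $a(u,v;s)=\langle v,f\rangle_{L_2(D)}$ for all $v\in L_2(D)$, and $\|u\|_{H(s;D)}\le C\|f\|_{L_2(D)}$; (ii) for every $f\in L_2(D\times S)$ there is exactly one $u\in H_{0,-}(D\times S)$ with $a(u,v)=\langle v,f\rangle_{L_2(D\times S)}$ for all $v\in L_2(D\times S)$, and $\|u\|_{H(D\times S)}\le C\|f\|_{L_2(D\times S)}$. -/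

import Mathlib

namespace Transport

open MeasureTheory Metric
open scoped ENNReal ContDiff

noncomputable section

/-- The Euclidean space `ℝ^d`. -/
abbrev Space (d : ℕ) := EuclideanSpace ℝ (Fin d)

/-- The unit sphere of directions. -/
abbrev Directions (d : ℕ) := sphere (0 : Space d) 1

/-- Lebesgue measure on the spatial domain `D`. -/
abbrev domainMeasure {d : ℕ} (D : Set (Space d)) : Measure (Space d) :=
  (volume : Measure (Space d)).restrict D

/-- Surface measure on the sphere of directions. -/
abbrev surfaceMeasure (d : ℕ) : Measure (Directions d) :=
  (volume : Measure (Space d)).toSphere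

/-- The product measure `dx ds` on the phase space `D × S`. -/
abbrev phaseMeasure {d : ℕ} (D : Set (Space d)) : Measure (Space d × Directions d) :=
  (domainMeasure D).prod (surfaceMeasure d)

/-- `L₂(D)`. -/
abbrev L2Domain {d : ℕ} (D : Set (Space d)) := Lp ℝ 2 (domainMeasure D)

/-- `L₂(D × S)`. -/
abbrev L2Phase {d : ℕ} (D : Set (Space d)) := Lp ℝ 2 (phaseMeasure D)

/-! Boundary portions -/

/-- `n` is a unit vector that is normal to a hyperplane supporting `D` at `x`, pointing
away from `D`. -/
def IsSupportingNormal {d : ℕ} (D : Set (Space d)) (x n : Space d) : Prop :=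
  ‖n‖ = 1 ∧ ∀ y ∈ D, inner ℝ n (y - x) ≤ 0

/-- The outward unit normal of the convex domain `D` is well defined at `x` and equals `n`
(at the edges and corners of a convex domain there are several supporting normals). -/
def IsOuterNormal {d : ℕ} (D : Set (Space d)) (x n : Space d) : Prop :=
  IsSupportingNormal D x n ∧ ∀ m, IsSupportingNormal D x m → m = n

/-- The inflow boundary `Γ₋(s)` for the direction `s`. -/
def fiberInflow {d : ℕ} (D : Set (Space d)) (s : Directions d) : Set (Space d) :=
  {x | x ∈ frontier D ∧ ∃ n, IsOuterNormal D x n ∧ inner ℝ (s : Space d) n < 0}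

/-- The inflow boundary `Γ₋ ⊆ ∂D × S` of the phase space. -/
def phaseInflow {d : ℕ} (D : Set (Space d)) : Set (Space d × Directions d) :=
  {z | z.1 ∈ frontier D ∧ ∃ n, IsOuterNormal D z.1 n ∧ inner ℝ (z.2 : Space d) n < 0}

/-! Integration of `L₂` functions against a fixed `L₂` function is linear -/

theorem integral_add_mul {α : Type*} [MeasurableSpace α] {μ : Measure α} (v w : Lp ℝ 2 μ)
    {g : α → ℝ} (hg : MemLp g 2 μ) :
    ∫ x, (v + w) x * g x ∂μ = ∫ x, v x * g x ∂μ + ∫ x, w x * g x ∂μ := by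
  have hv : Integrable (fun x => v x * g x) μ := (Lp.memLp v).integrable_mul hg
  have hw : Integrable (fun x => w x * g x) μ := (Lp.memLp w).integrable_mul hg
  rw [← integral_add hv hw]
  refine integral_congr_ae ?_
  filter_upwards [Lp.coeFn_add v w] with x hx
  rw [hx, Pi.add_apply, add_mul]

theorem integral_smul_mul {α : Type*} [MeasurableSpace α] {μ : Measure α} (c : ℝ)
    (v : Lp ℝ 2 μ) (g : α → ℝ) :
    ∫ x, (c • v) x * g x ∂μ = c * ∫ x, v x * g x ∂μ := by
  rw [← integral_const_mul]
  refine integral_congr_ae ?_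
  filter_upwards [Lp.coeFn_smul c v] with x hx
  simp [hx, mul_assoc]

theorem integral_zero_mul {α : Type*} [MeasurableSpace α] {μ : Measure α} (g : α → ℝ) :
    ∫ x, (0 : Lp ℝ 2 μ) x * g x ∂μ = 0 := by
  simpa using integral_smul_mul (0 : ℝ) (0 : Lp ℝ 2 μ) g

/-! The fiber spaces -/

/-- `w` is the weak directional derivative `s · ∇v` of `v` in `D`. -/
def HasWeakDirDeriv {d : ℕ} (D : Set (Space d)) (s : Directions d) (v w : L2Domain D) : Prop :=
  ∀ φ : Space d → ℝ, ContDiff ℝ ∞ φ → HasCompactSupport φ → tsupport φ ⊆ D →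
    ∫ x, v x * fderiv ℝ φ x s ∂(domainMeasure D) = -∫ x, w x * φ x ∂(domainMeasure D)

theorem memLp_test {d : ℕ} {D : Set (Space d)} {φ : Space d → ℝ} (hφ : ContDiff ℝ ∞ φ)
    (hc : HasCompactSupport φ) : MemLp φ 2 (domainMeasure D) :=
  hφ.continuous.memLp_of_hasCompactSupport hc

theorem memLp_test_deriv {d : ℕ} {D : Set (Space d)} {φ : Space d → ℝ} (hφ : ContDiff ℝ ∞ φ)
    (hc : HasCompactSupport φ) (s : Space d) :
    MemLp (fun x => fderiv ℝ φ x s) 2 (domainMeasure D) :=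
  ((hφ.continuous_fderiv (by simp)).clm_apply continuous_const).memLp_of_hasCompactSupport
    (hc.fderiv_apply ℝ s)

/-- The Hilbert space `H(s; D)` of all `v ∈ L₂(D)` with `s · ∇v ∈ L₂(D)`. Its element `v` is
stored as the pair `(v, s · ∇v)`, so that the norm of the `ℓ₂`-product is the norm
`(‖v‖² + ‖s · ∇v‖²)^{1/2}` of `H(s; D)`. -/
def fiberSpace {d : ℕ} (D : Set (Space d)) (s : Directions d) :
    Submodule ℝ (WithLp 2 (L2Domain D × L2Domain D)) where
  carrier := {p | HasWeakDirDeriv D s p.fst p.snd}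
  zero_mem' := by
    intro φ _ _ _
    rw [WithLp.zero_fst, WithLp.zero_snd, integral_zero_mul, integral_zero_mul, neg_zero]
  add_mem' := by
    intro p q hp hq φ h1 h2 h3
    rw [WithLp.add_fst, WithLp.add_snd, integral_add_mul _ _ (memLp_test_deriv h1 h2 s),
      integral_add_mul _ _ (memLp_test h1 h2), hp φ h1 h2 h3, hq φ h1 h2 h3]
    ring
  smul_mem' := by
    intro c p hp φ h1 h2 h3
    rw [WithLp.smul_fst, WithLp.smul_snd, integral_smul_mul, integral_smul_mul, hp φ h1 h2 h3]
    ring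

/-- The functions in `C¹(D̄)` that vanish on `Γ₋(s)`, as a subspace of `H(s; D)`; here `C¹(D̄)`
consists of the restrictions of the `C¹` functions on `ℝ^d`. -/
def fiberC1 {d : ℕ} (D : Set (Space d)) (s : Directions d) : Submodule ℝ (fiberSpace D s) where
  carrier := {p | ∃ φ : Space d → ℝ, ContDiff ℝ 1 φ ∧ (∀ x ∈ fiberInflow D s, φ x = 0) ∧
    p.1.fst =ᵐ[domainMeasure D] φ ∧
    p.1.snd =ᵐ[domainMeasure D] fun x => fderiv ℝ φ x s}
  zero_mem' := by
    refine ⟨fun _ => 0, contDiff_const, fun _ _ => rfl, ?_, ?_⟩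
    · filter_upwards [Lp.coeFn_zero ℝ 2 (domainMeasure D)] with x e
      exact e.trans (by simp)
    · filter_upwards [Lp.coeFn_zero ℝ 2 (domainMeasure D)] with x e
      exact e.trans (by simp)
  add_mem' := by
    rintro p q ⟨φ, h1, h2, h3, h4⟩ ⟨ψ, k1, k2, k3, k4⟩
    refine ⟨fun x => φ x + ψ x, h1.add k1, fun x hx => by simp [h2 x hx, k2 x hx], ?_, ?_⟩
    · filter_upwards [Lp.coeFn_add p.1.fst q.1.fst, h3, k3] with x e1 e2 e3
      exact e1.trans (by simp [e2, e3])
    · filter_upwards [Lp.coeFn_add p.1.snd q.1.snd, h4, k4] with x e1 e2 e3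
      rw [fderiv_fun_add (h1.differentiable one_ne_zero x) (k1.differentiable one_ne_zero x)]
      exact e1.trans (by simp [e2, e3])
  smul_mem' := by
    rintro c p ⟨φ, h1, h2, h3, h4⟩
    refine ⟨fun x => c * φ x, contDiff_const.mul h1, fun x hx => by simp [h2 x hx], ?_, ?_⟩
    · filter_upwards [Lp.coeFn_smul c p.1.fst, h3] with x e1 e2
      simp [e1, e2]
    · filter_upwards [Lp.coeFn_smul c p.1.snd, h4] with x e1 e2
      rw [fderiv_const_mul (h1.differentiable one_ne_zero x)]
      simp [e1, e2]

/-- The space `H_{0,Γ₋(s)}(s; D)`: the closure of `fiberC1` in `H(s; D)`. -/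
def fiberTrial {d : ℕ} (D : Set (Space d)) (s : Directions d) : Submodule ℝ (fiberSpace D s) :=
  (fiberC1 D s).topologicalClosure

/-! The lifted spaces -/

/-- `w` is the weak derivative `s · ∇ₓ v` of `v` in `D × S`. Test functions are the
restrictions to `D × S` of the smooth functions on `ℝ^d × ℝ^d` with compact support in
`D × ℝ^d`. -/
def HasWeakTransportDeriv {d : ℕ} (D : Set (Space d)) (v w : L2Phase D) : Prop :=
  ∀ φ : Space d × Space d → ℝ, ContDiff ℝ ∞ φ → HasCompactSupport φ →
    tsupport φ ⊆ D ×ˢ Set.univ →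
    ∫ z, v z * fderiv ℝ φ (z.1, (z.2 : Space d)) ((z.2 : Space d), 0) ∂(phaseMeasure D) =
      -∫ z, w z * φ (z.1, (z.2 : Space d)) ∂(phaseMeasure D)

theorem isClosedEmbedding_phase (d : ℕ) : Topology.IsClosedEmbedding
    (fun z : Space d × Directions d => (z.1, (z.2 : Space d))) :=
  Topology.IsClosedEmbedding.id.prodMap isClosed_sphere.isClosedEmbedding_subtypeVal

theorem memLp_phaseTest {d : ℕ} {D : Set (Space d)} {φ : Space d × Space d → ℝ}
    (hφ : ContDiff ℝ ∞ φ) (hc : HasCompactSupport φ) :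
    MemLp (fun z : Space d × Directions d => φ (z.1, (z.2 : Space d))) 2 (phaseMeasure D) :=
  (hφ.continuous.comp (isClosedEmbedding_phase d).continuous).memLp_of_hasCompactSupport
    (hc.comp_isClosedEmbedding (isClosedEmbedding_phase d))

theorem memLp_phaseTest_deriv {d : ℕ} {D : Set (Space d)} {φ : Space d × Space d → ℝ}
    (hφ : ContDiff ℝ ∞ φ) (hc : HasCompactSupport φ) :
    MemLp (fun z : Space d × Directions d =>
      fderiv ℝ φ (z.1, (z.2 : Space d)) ((z.2 : Space d), 0)) 2 (phaseMeasure D) := by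
  have h1 : Continuous (fun z : Space d × Directions d =>
      fderiv ℝ φ (z.1, (z.2 : Space d)) ((z.2 : Space d), 0)) :=
    ((hφ.continuous_fderiv (by simp)).comp (isClosedEmbedding_phase d).continuous).clm_apply
      (by fun_prop)
  refine h1.memLp_of_hasCompactSupport ?_
  refine ((hc.fderiv ℝ).comp_isClosedEmbedding (isClosedEmbedding_phase d)).mono ?_
  intro z hz
  contrapose! hz
  simp only [Function.mem_support, Function.comp_apply, not_not] at hz ⊢
  rw [hz]
  simp

/-- The Hilbert space `H(D × S)` of all `v ∈ L₂(D × S)` with `s · ∇ₓ v ∈ L₂(D × S)`. Its element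
`v` is stored as the pair `(v, s · ∇ₓ v)`, so that the norm of the `ℓ₂`-product is the norm
`(‖v‖² + ‖s · ∇ₓ v‖²)^{1/2}` of `H(D × S)`. -/
def phaseSpace {d : ℕ} (D : Set (Space d)) :
    Submodule ℝ (WithLp 2 (L2Phase D × L2Phase D)) where
  carrier := {p | HasWeakTransportDeriv D p.fst p.snd}
  zero_mem' := by
    intro φ _ _ _
    rw [WithLp.zero_fst, WithLp.zero_snd, integral_zero_mul, integral_zero_mul, neg_zero]
  add_mem' := by
    intro p q hp hq φ h1 h2 h3
    rw [WithLp.add_fst, WithLp.add_snd, integral_add_mul _ _ (memLp_phaseTest_deriv h1 h2),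
      integral_add_mul _ _ (memLp_phaseTest h1 h2), hp φ h1 h2 h3, hq φ h1 h2 h3]
    ring
  smul_mem' := by
    intro c p hp φ h1 h2 h3
    rw [WithLp.smul_fst, WithLp.smul_snd, integral_smul_mul, integral_smul_mul, hp φ h1 h2 h3]
    ring

/-- The `C¹` functions on the closure `D̄ × S` of the phase space that vanish on `Γ₋`, as a
subspace of `H(D × S)`; the `C¹` functions on `D̄ × S` are the restrictions of the `C¹` functions
on `ℝ^d × ℝ^d`. -/
def phaseC1 {d : ℕ} (D : Set (Space d)) : Submodule ℝ (phaseSpace D) where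
  carrier := {p | ∃ φ : Space d × Space d → ℝ, ContDiff ℝ 1 φ ∧
    (∀ z ∈ phaseInflow D, φ (z.1, (z.2 : Space d)) = 0) ∧
    p.1.fst =ᵐ[phaseMeasure D] (fun z => φ (z.1, (z.2 : Space d))) ∧
    p.1.snd =ᵐ[phaseMeasure D] fun z =>
      fderiv ℝ φ (z.1, (z.2 : Space d)) ((z.2 : Space d), 0)}
  zero_mem' := by
    refine ⟨fun _ => 0, contDiff_const, fun _ _ => rfl, ?_, ?_⟩
    · filter_upwards [Lp.coeFn_zero ℝ 2 (phaseMeasure D)] with x e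
      exact e.trans (by simp)
    · filter_upwards [Lp.coeFn_zero ℝ 2 (phaseMeasure D)] with x e
      exact e.trans (by simp)
  add_mem' := by
    rintro p q ⟨φ, h1, h2, h3, h4⟩ ⟨ψ, k1, k2, k3, k4⟩
    refine ⟨fun x => φ x + ψ x, h1.add k1, fun x hx => by simp [h2 x hx, k2 x hx], ?_, ?_⟩
    · filter_upwards [Lp.coeFn_add p.1.fst q.1.fst, h3, k3] with x e1 e2 e3
      exact e1.trans (by simp [e2, e3])
    · filter_upwards [Lp.coeFn_add p.1.snd q.1.snd, h4, k4] with x e1 e2 e3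
      rw [fderiv_fun_add (h1.differentiable one_ne_zero _) (k1.differentiable one_ne_zero _)]
      exact e1.trans (by simp [e2, e3])
  smul_mem' := by
    rintro c p ⟨φ, h1, h2, h3, h4⟩
    refine ⟨fun x => c * φ x, contDiff_const.mul h1, fun x hx => by simp [h2 x hx], ?_, ?_⟩
    · filter_upwards [Lp.coeFn_smul c p.1.fst, h3] with x e1 e2
      simp [e1, e2]
    · filter_upwards [Lp.coeFn_smul c p.1.snd, h4] with x e1 e2
      rw [fderiv_const_mul (h1.differentiable one_ne_zero _)]
      simp [e1, e2]

/-- The space `H_{0,-}(D × S)`: the closure of `phaseC1` in `H(D × S)`. -/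
def phaseTrial {d : ℕ} (D : Set (Space d)) : Submodule ℝ (phaseSpace D) :=
  (phaseC1 D).topologicalClosure

/-! The bilinear forms -/

/-- `∫_D (g + τ u) v dx`. -/
def transportIntegral {d : ℕ} (D : Set (Space d)) (τ g u v : Space d → ℝ) : ℝ :=
  ∫ x, (g x + τ x * u x) * v x ∂(domainMeasure D)

/-- The fiber form `a(u, v; s) = ∫_D (s · ∇u + σ(·, s) u) v dx`. -/
def fiberForm {d : ℕ} (D : Set (Space d)) (σ : Space d × Directions d → ℝ) (s : Directions d)
    (u : fiberTrial D s) (v : L2Domain D) : ℝ :=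
  transportIntegral D (fun x => σ (x, s)) u.1.1.snd u.1.1.fst v

/-- The lifted form `a(u, v) = ∫_S ∫_D (s · ∇ₓ u(x, s) + σ(x, s) u(x, s)) v(x, s) dx ds`. -/
def phaseForm {d : ℕ} (D : Set (Space d)) (σ : Space d × Directions d → ℝ)
    (u : phaseTrial D) (v : L2Phase D) : ℝ :=
  ∫ s, transportIntegral D (fun x => σ (x, s)) (fun x => u.1.1.snd (x, s))
    (fun x => u.1.1.fst (x, s)) (fun x => v (x, s)) ∂(surfaceMeasure d)

end

end Transport

namespace Transport

open MeasureTheory Metric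
open scoped ENNReal ContDiff

noncomputable section

/-! Write `T u = s · ∇u`, `P u = u`, and let `M` be multiplication by `σ`; the problem is `T u + M
(P u) = f`. Choose `R` with `D` in the closed ball of radius `R` about `0`. The weight `w(x) = R - s
· x` satisfies `0 ≤ w ≤ 2R` on `D` and `s · ∇w = -1`, so `s · ∇(w φ²) = 2 w φ (s · ∇φ) - φ²`. If `φ`
vanishes on the inflow boundary, the flux of `w φ²` through `∂D` is non-negative, hence `‖φ‖² ≤ 2 ⟨w
φ, s · ∇φ⟩` (`integral_sq_le_of_fiberInflow`). This passes to closures, and replacing `T` by `T + t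
M P` with `t ≥ 0` only enlarges the right-hand side because `w σ ≥ 0`. Thus `T + t M P` is bounded
below uniformly in `t ∈ [0, 1]` and in `s`, which gives uniqueness and the estimate.

For existence, a test function `G` supported in `D` is integrated backwards along rays. The result
is `C¹`, vanishes on the inflow boundary and has transport derivative `G` in `D`; so `T` has dense
range, which is closed by the lower bound. The method of continuity
(`surjective_add_of_bounded_below`) carries surjectivity from `T` to `T + M P`.

The sign of the flux is obtained without a trace or divergence theorem, by differentiating `∫_D ψ(x
- h s) dx` at `h = 0` (`integral_fderiv_nonneg_of_entry`). Since functions are only assumed to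
vanish where the normal is unique, it is also needed that such inflow points are dense among the
points where lines of direction `s` enter `D` (`mem_closure_fiberInflow`). The lifted problem uses
the same argument, with the energy inequality integrated over `s` and ray integrals that are jointly
`C¹` in position and direction. -/

/-! ### Abstract well-posedness from an energy inequality -/

/-- Multiplication by a bounded measurable function is a bounded operator on `L₂`. -/
theorem exists_mulOperator {α : Type*} [MeasurableSpace α] {μ : Measure α} {g : α → ℝ} {B : ℝ}
    (hg : AEStronglyMeasurable g μ) (hB : ∀ᵐ x ∂μ, |g x| ≤ B) :
    ∃ M : Lp ℝ 2 μ →L[ℝ] Lp ℝ 2 μ, (∀ v, M v =ᵐ[μ] fun x => g x * v x) ∧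
      ∀ v, ‖M v‖ ≤ B * ‖v‖ := by
  have hmem : ∀ v : Lp ℝ 2 μ, MemLp (fun x => g x * v x) 2 μ := fun v => by
    refine (Lp.memLp v).of_le_mul (c := B) (hg.mul (Lp.aestronglyMeasurable v)) ?_
    filter_upwards [hB] with x hx
    rw [norm_mul]
    exact mul_le_mul_of_nonneg_right hx (norm_nonneg _)
  have hbound : ∀ v : Lp ℝ 2 μ, ‖(hmem v).toLp _‖ ≤ B * ‖v‖ := fun v => by
    refine Lp.norm_le_mul_norm_of_ae_le_mul ?_
    filter_upwards [hB, (hmem v).coeFn_toLp] with x hx hx'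
    rw [hx', norm_mul]
    exact mul_le_mul_of_nonneg_right hx (norm_nonneg _)
  let L : Lp ℝ 2 μ →ₗ[ℝ] Lp ℝ 2 μ :=
    { toFun := fun v => (hmem v).toLp _
      map_add' := fun v w => by
        ext1
        filter_upwards [(hmem (v + w)).coeFn_toLp, (hmem v).coeFn_toLp, (hmem w).coeFn_toLp,
          Lp.coeFn_add v w, Lp.coeFn_add ((hmem v).toLp _) ((hmem w).toLp _)] with x h1 h2 h3 h4 h5
        rw [h1, h5, Pi.add_apply, h2, h3, h4, Pi.add_apply, mul_add]
      map_smul' := fun c v => by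
        ext1
        filter_upwards [(hmem (c • v)).coeFn_toLp, (hmem v).coeFn_toLp,
          Lp.coeFn_smul c v, Lp.coeFn_smul c ((hmem v).toLp _)] with x h1 h2 h3 h4
        simp only [RingHom.id_apply]
        rw [h1, h4, Pi.smul_apply, h2, h3, Pi.smul_apply, smul_eq_mul, smul_eq_mul]
        ring }
  exact ⟨L.mkContinuous B hbound, fun v => (hmem v).coeFn_toLp, hbound⟩

theorem inner_eq_integral_mul {α : Type*} [MeasurableSpace α] {μ : Measure α}
    (v w : Lp ℝ 2 μ) : inner ℝ v w = ∫ x, v x * w x ∂μ := by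
  rw [L2.inner_def]
  refine integral_congr_ae (Filter.Eventually.of_forall fun x => ?_)
  simp [mul_comm]

/-- A bounded operator that is bounded below has full range if no non-zero vector is orthogonal
to its range. -/
theorem surjective_of_bounded_below {E F : Type*} [SeminormedAddCommGroup E] [NormedSpace ℝ E]
    [CompleteSpace E] [NormedAddCommGroup F] [InnerProductSpace ℝ F] [CompleteSpace F]
    (L : E →L[ℝ] F) {C : ℝ} (hC : 0 ≤ C) (hL : ∀ u, ‖u‖ ≤ C * ‖L u‖)
    (h : ∀ f, (∀ u, inner ℝ (L u) f = 0) → f = 0) : Function.Surjective L := by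
  have hanti : AntilipschitzWith ⟨C, hC⟩ L := L.antilipschitz_of_bound hL
  have hclosed : IsClosed (L.range : Set F) := by
    exact hanti.isClosed_range L.uniformContinuous
  have : L.range = ⊤ := by
    have : CompleteSpace L.range := hclosed.completeSpace_coe
    rw [← Submodule.orthogonal_eq_bot_iff, Submodule.eq_bot_iff]
    intro f hf
    refine h f fun u => ?_
    exact hf (L u) ⟨u, rfl⟩
  exact LinearMap.range_eq_top.1 this

/-- The method of continuity along the segment from `T` to `T + M`. -/
theorem surjective_add_of_bounded_below {E F : Type*} [SeminormedAddCommGroup E] [NormedSpace ℝ E]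
    [CompleteSpace E] [NormedAddCommGroup F] [InnerProductSpace ℝ F] [CompleteSpace F]
    (T M : E →L[ℝ] F) {C : ℝ} (hC : 0 ≤ C)
    (hL : ∀ t : ℝ, 0 ≤ t → t ≤ 1 → ∀ u, ‖u‖ ≤ C * ‖T u + t • M u‖)
    (h : ∀ f, (∀ u, inner ℝ (T u) f = 0) → f = 0) : Function.Surjective (T + M) := by
  -- The segment is cut into `N` steps so short that one step perturbs the operator by relative size
  -- `‖M‖ * C / N < 1`.
  obtain ⟨N, hN⟩ := exists_nat_gt (‖M‖ * C)
  have hN0 : (0 : ℝ) < N := lt_of_le_of_lt (by positivity) hN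
  -- The induction carries triviality of the orthogonal complement of the range; with the lower
  -- bound this is as good as surjectivity.
  have key : ∀ k : ℕ, k ≤ N →
      ∀ f, (∀ u, inner ℝ (T u + ((k : ℝ) / N) • M u) f = 0) → f = 0 := by
    intro k
    induction k with
    | zero => intro _ f hf; exact h f fun u => by simpa using hf u
    | succ k ih =>
      intro hk f hf
      have hkN : ((k : ℝ) / N) ≤ 1 := by
        rw [div_le_one hN0]; exact_mod_cast (Nat.le_of_succ_le hk)
      have hs := surjective_of_bounded_below (T + ((k : ℝ) / N) • M) hC
        (fun u => by simpa using hL _ (by positivity) hkN u)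
        (by simpa using ih (Nat.le_of_succ_le hk))
      obtain ⟨u, hu⟩ := hs f
      have hu' : T u + ((k : ℝ) / N) • M u = f := by simpa using hu
      have h1 : ‖u‖ ≤ C * ‖f‖ := hu' ▸ hL _ (by positivity) hkN u
      have h2 := hf u
      have h3 : T u + (((k + 1 : ℕ) : ℝ) / N) • M u = f + (1 / (N : ℝ)) • M u := by
        rw [← hu', add_assoc, ← add_smul]
        congr 2
        push_cast
        ring
      -- Orthogonality of `f` to the next range becomes `‖f‖² + ⟨M u, f⟩ / N = 0`, and the second
      -- term is too small to cancel the first unless `f = 0`.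
      rw [h3, inner_add_left, real_inner_self_eq_norm_sq, real_inner_smul_left] at h2
      have h4 : |inner ℝ (M u) f| ≤ (‖M‖ * C) * ‖f‖ ^ 2 := by
        refine (abs_real_inner_le_norm _ _).trans ?_
        calc ‖M u‖ * ‖f‖ ≤ (‖M‖ * (C * ‖f‖)) * ‖f‖ := by
              gcongr
              exact (M.le_opNorm u).trans (by gcongr)
          _ = _ := by ring
      have h5 : (N : ℝ) * ‖f‖ ^ 2 = -inner ℝ (M u) f := by
        field_simp at h2
        linarith
      have h6 := neg_abs_le (inner ℝ (M u) f)
      have h7 : ((N : ℝ) - ‖M‖ * C) * ‖f‖ ^ 2 ≤ 0 := by linarith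
      have h8 : ‖f‖ ^ 2 ≤ 0 := by
        by_contra hc
        exact absurd h7 (not_le.2 (mul_pos (sub_pos.2 hN) (not_le.1 hc)))
      exact norm_eq_zero.1 (pow_eq_zero_iff two_ne_zero |>.1 (le_antisymm h8 (sq_nonneg _)))
  refine surjective_of_bounded_below (T + M) hC
    (fun u => by simpa using hL 1 zero_le_one le_rfl u) ?_
  have := key N le_rfl
  rw [div_self hN0.ne'] at this
  simpa using this

theorem norm_le_norm_fst_add_norm_snd {E F : Type*} [NormedAddCommGroup E]
    [NormedAddCommGroup F] (p : WithLp 2 (E × F)) : ‖p‖ ≤ ‖p.fst‖ + ‖p.snd‖ := by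
  rw [WithLp.prod_norm_eq_of_L2]
  refine Real.sqrt_le_iff.2 ⟨by positivity, ?_⟩
  nlinarith [norm_nonneg p.fst, norm_nonneg p.snd]

/-- Well-posedness of `T u + M (P u) = f` in the closure of a space `K` on which an energy
inequality holds with the weight `N`, if the values of `T` on `K` are dense. -/
theorem wellPosed_of_energy_operator {V H : Type*} [NormedAddCommGroup V] [NormedSpace ℝ V]
    [CompleteSpace V] [NormedAddCommGroup H] [InnerProductSpace ℝ H] [CompleteSpace H]
    (P T : V →L[ℝ] H) (hPT : ∀ u, ‖u‖ ≤ ‖P u‖ + ‖T u‖) (K : Submodule ℝ V) (M N : H →L[ℝ] H)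
    {B W : ℝ} (hB : 0 ≤ B) (hW : 0 ≤ W) (hM : ∀ v, ‖M v‖ ≤ B * ‖v‖) (hN : ∀ v, ‖N v‖ ≤ W * ‖v‖)
    (hnonneg : ∀ v, 0 ≤ inner ℝ (N v) (M v))
    (henergy : ∀ u ∈ K, ‖P u‖ ^ 2 ≤ 2 * inner ℝ (N (P u)) (T u))
    (hdense : ∀ f : H, (∀ u ∈ K, inner ℝ (T u) f = 0) → f = 0) (f : H) :
    (∃! u : K.topologicalClosure, T u + M (P u) = f) ∧
    ∀ u : K.topologicalClosure, T u + M (P u) = f →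
      ‖u‖ ≤ (1 + (1 + B) * (2 * W)) * ‖f‖ := by
  have : CompleteSpace K.topologicalClosure :=
    K.isClosed_topologicalClosure.completeSpace_coe
  have hen : ∀ u ∈ K.topologicalClosure, ‖P u‖ ^ 2 ≤ 2 * inner ℝ (N (P u)) (T u) := by
    have hcl : IsClosed {u : V | ‖P u‖ ^ 2 ≤ 2 * inner ℝ (N (P u)) (T u)} :=
      isClosed_le (by fun_prop)
        (continuous_const.mul ((N.continuous.comp P.continuous).inner T.continuous))
    exact fun u hu => closure_minimal (s := (K : Set V)) henergy hcl hu
  -- The added term contributes `t ⟨N (P u), M (P u)⟩ ≥ 0` to the energy inequality, so the bound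
  -- does not depend on `t`.
  have hP : ∀ t : ℝ, 0 ≤ t → ∀ u ∈ K.topologicalClosure,
      ‖P u‖ ≤ 2 * W * ‖T u + t • M (P u)‖ := by
    intro t ht u hu
    have h1 : ‖P u‖ ^ 2 ≤ 2 * inner ℝ (N (P u)) (T u + t • M (P u)) := by
      rw [inner_add_right, real_inner_smul_right]
      linarith [hen u hu, mul_nonneg ht (hnonneg (P u))]
    have h2 : inner ℝ (N (P u)) (T u + t • M (P u)) ≤
        W * ‖P u‖ * ‖T u + t • M (P u)‖ :=
      (real_inner_le_norm _ _).trans (mul_le_mul_of_nonneg_right (hN _) (norm_nonneg _))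
    rcases (norm_nonneg (P u)).eq_or_lt with h0 | h0
    · rw [← h0]; positivity
    · refine le_of_mul_le_mul_left ?_ h0
      linarith
  have hbelow : ∀ t : ℝ, 0 ≤ t → t ≤ 1 → ∀ u : K.topologicalClosure,
      ‖u‖ ≤ (1 + (1 + B) * (2 * W)) * ‖T u + t • M (P u)‖ := by
    intro t ht ht1 u
    have h1 := hP t ht u u.2
    have h2 : ‖T u‖ ≤ ‖T u + t • M (P u)‖ + B * ‖P u‖ := by
      calc ‖T u‖ = ‖(T u + t • M (P u)) - t • M (P u)‖ := by rw [add_sub_cancel_right]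
        _ ≤ ‖T u + t • M (P u)‖ + ‖t • M (P u)‖ := norm_sub_le _ _
        _ ≤ _ := by
            gcongr
            rw [norm_smul, Real.norm_of_nonneg ht]
            exact (mul_le_of_le_one_left (norm_nonneg _) ht1).trans (hM _)
    have h3 : ‖u‖ ≤ ‖P u‖ + ‖T u‖ := hPT u
    have h4 := mul_le_mul_of_nonneg_left h1 hB
    linarith
  have hC : 0 ≤ 1 + (1 + B) * (2 * W) := by positivity
  have hsurj := surjective_add_of_bounded_below (T ∘L K.topologicalClosure.subtypeL)
    (M ∘L P ∘L K.topologicalClosure.subtypeL) hC hbelow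
    (fun g hg => hdense g fun p hp => hg ⟨p, subset_closure hp⟩)
  have hbd : ∀ u : K.topologicalClosure,
      ‖u‖ ≤ (1 + (1 + B) * (2 * W)) * ‖T u + M (P u)‖ := fun u => by
    simpa using hbelow 1 zero_le_one le_rfl u
  refine ⟨?_, fun u hu => hu ▸ hbd u⟩
  obtain ⟨u, hu⟩ := hsurj f
  refine ⟨u, hu, fun u' hu' => ?_⟩
  have h1 := hbd (u' - u)
  have h2 : T u + M (P u) = f := hu
  have h3 : T (u' - u : K.topologicalClosure) + M (P (u' - u : K.topologicalClosure)) =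
      (T u' + M (P u')) - (T u + M (P u)) := by
    rw [Submodule.coe_sub, map_sub, map_sub, map_sub]
    abel
  rw [h3, hu', h2, sub_self, norm_zero, mul_zero] at h1
  exact sub_eq_zero.1 (norm_le_zero_iff.1 h1)

/-- Well-posedness of `p.snd + σ p.fst = f` in the closure of a space `K` of pairs of `L₂`
functions on which an energy inequality holds with a bounded weight `w`, if the second components
are dense. -/
theorem wellPosed_of_energy {α : Type*} [MeasurableSpace α] {μ : Measure α}
    {X : Submodule ℝ (WithLp 2 (Lp ℝ 2 μ × Lp ℝ 2 μ))}
    (hX : IsClosed (X : Set (WithLp 2 (Lp ℝ 2 μ × Lp ℝ 2 μ))))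
    (K : Submodule ℝ X) {σ w : α → ℝ} {B W : ℝ} (hB : 0 ≤ B) (hW : 0 ≤ W)
    (hσm : AEStronglyMeasurable σ μ) (hσ : ∀ᵐ x ∂μ, 0 ≤ σ x ∧ σ x ≤ B)
    (hwm : AEStronglyMeasurable w μ) (hw : ∀ᵐ x ∂μ, 0 ≤ w x ∧ w x ≤ W)
    (henergy : ∀ p ∈ K, ∫ x, p.1.fst x ^ 2 ∂μ ≤ 2 * ∫ x, w x * p.1.fst x * p.1.snd x ∂μ)
    (hdense : ∀ f : Lp ℝ 2 μ, (∀ p ∈ K, ∫ x, p.1.snd x * f x ∂μ = 0) → f = 0)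
    (f : Lp ℝ 2 μ) :
    (∃! u : K.topologicalClosure,
      ∀ v : Lp ℝ 2 μ, ∫ x, (u.1.1.snd x + σ x * u.1.1.fst x) * v x ∂μ = inner ℝ v f) ∧
    ∀ u : K.topologicalClosure,
      (∀ v : Lp ℝ 2 μ, ∫ x, (u.1.1.snd x + σ x * u.1.1.fst x) * v x ∂μ = inner ℝ v f) →
        ‖u‖ ≤ (1 + (1 + B) * (2 * W)) * ‖f‖ := by
  obtain ⟨M, hM, hMB⟩ := exists_mulOperator hσm
    (hσ.mono fun x hx => abs_le.2 ⟨by linarith [hx.1], hx.2⟩)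
  obtain ⟨N, hN, hNW⟩ := exists_mulOperator hwm
    (hw.mono fun x hx => abs_le.2 ⟨by linarith [hx.1], hx.2⟩)
  have hnonneg : ∀ v, 0 ≤ inner ℝ (N v) (M v) := fun v => by
    rw [inner_eq_integral_mul]
    refine integral_nonneg_of_ae ?_
    filter_upwards [hN v, hM v, hw, hσ] with x h1 h2 h3 h4
    rw [h1, h2, Pi.zero_apply,
      show w x * v x * (σ x * v x) = w x * σ x * (v x * v x) by ring]
    exact mul_nonneg (mul_nonneg h3.1 h4.1) (mul_self_nonneg _)
  -- As `v` ranges over all of `L₂`, the variational equation is the same as the equation in `L₂`.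
  have hiff : ∀ p : WithLp 2 (Lp ℝ 2 μ × Lp ℝ 2 μ),
      (∀ v : Lp ℝ 2 μ, ∫ x, (p.snd x + σ x * p.fst x) * v x ∂μ = inner ℝ v f) ↔
        p.snd + M p.fst = f := by
    intro p
    have : ∀ v : Lp ℝ 2 μ, ∫ x, (p.snd x + σ x * p.fst x) * v x ∂μ =
        inner ℝ v (p.snd + M p.fst) := by
      intro v
      rw [inner_eq_integral_mul]
      refine integral_congr_ae ?_
      filter_upwards [Lp.coeFn_add p.snd (M p.fst), hM p.fst] with x h1 h2
      rw [h1, Pi.add_apply, h2, mul_comm]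
    simp only [this]
    exact ⟨fun h => ext_inner_left ℝ h, fun h v => by rw [h]⟩
  have hen : ∀ p ∈ K, ‖p.1.fst‖ ^ 2 ≤ 2 * inner ℝ (N p.1.fst) p.1.snd := by
    intro p hp
    rw [← real_inner_self_eq_norm_sq, inner_eq_integral_mul, inner_eq_integral_mul]
    convert henergy p hp using 2
    · simp only [pow_two]
    · refine integral_congr_ae ?_
      filter_upwards [hN p.1.fst] with x hx
      rw [hx]
  have : CompleteSpace X := hX.completeSpace_coe
  have key := wellPosed_of_energy_operator (WithLp.fstL 2 ℝ _ _ ∘L X.subtypeL)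
    (WithLp.sndL 2 ℝ _ _ ∘L X.subtypeL) (fun u => norm_le_norm_fst_add_norm_snd u.1) K M N hB hW
    hMB hNW hnonneg hen
    (fun f hf => hdense f fun p hp => by rw [← inner_eq_integral_mul]; exact hf p hp) f
  simp only [hiff]
  exact key

/-! ### Supporting normals and entry points of a convex domain -/

/-- A supporting normal at a boundary point touched by an interior ball is the direction from the
centre of the ball to the point. -/
theorem IsSupportingNormal.eq_of_ball_subset {d : ℕ} {D : Set (Space d)} {p y m : Space d}
    (hpy : p ≠ y) (hball : ball p (dist p y) ⊆ D) (hm : IsSupportingNormal D y m) :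
    m = ‖y - p‖⁻¹ • (y - p) := by
  have hρ : 0 < ‖y - p‖ := norm_pos_iff.2 (sub_ne_zero.2 hpy.symm)
  have hdist : dist p y = ‖y - p‖ := by rw [dist_comm, dist_eq_norm]
  -- The supporting inequality is tested at `p + t • m` inside the ball. Letting `t` tend to the
  -- radius forces equality in Cauchy–Schwarz between `m` and `y - p`.
  have h1 : ∀ t : ℝ, 0 ≤ t → t < ‖y - p‖ → inner ℝ m (p - y) + t ≤ 0 := by
    intro t ht0 ht
    have := hm.2 (p + t • m) (hball (by
      rw [mem_ball, dist_eq_norm, add_sub_cancel_left, norm_smul, hm.1, mul_one,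
        Real.norm_of_nonneg ht0, hdist]
      exact ht))
    rwa [add_sub_right_comm, inner_add_right, real_inner_smul_right, real_inner_self_eq_norm_sq,
      hm.1, one_pow, mul_one] at this
  have h2 : ‖y - p‖ ≤ inner ℝ m (y - p) := by
    have : inner ℝ m (y - p) = -inner ℝ m (p - y) := by rw [← inner_neg_right, neg_sub]
    rw [this]
    refine le_of_forall_lt_imp_le_of_dense fun t ht => ?_
    rcases lt_or_ge t 0 with h0 | h0
    · linarith [h1 0 le_rfl hρ]
    · linarith [h1 t h0 ht]
  rw [← sub_eq_zero, ← norm_eq_zero, ← sq_eq_zero_iff]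
  refine le_antisymm ?_ (sq_nonneg _)
  rw [norm_sub_sq_real, hm.1, real_inner_smul_right, norm_smul, norm_inv, norm_norm,
    inv_mul_cancel₀ hρ.ne']
  have : 1 ≤ ‖y - p‖⁻¹ * inner ℝ m (y - p) := by
    rw [← div_eq_inv_mul, le_div_iff₀ hρ, one_mul]; exact h2
  linarith

/-- A convex domain has a supporting normal at every point of its complement. -/
theorem exists_isSupportingNormal {d : ℕ} {D : Set (Space d)} (hopen : IsOpen D)
    (hconv : Convex ℝ D) (hne : D.Nonempty) {y : Space d} (hy : y ∉ D) :
    ∃ n, IsSupportingNormal D y n := by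
  obtain ⟨f, hf⟩ := geometric_hahn_banach_open_point hconv hopen hy
  set m := (InnerProductSpace.toDual ℝ (Space d)).symm f
  have hm : ∀ a, inner ℝ m a = f a := fun a => InnerProductSpace.toDual_symm_apply
  obtain ⟨a, ha⟩ := hne
  have hm0 : m ≠ 0 := by
    intro h0
    have := hf a ha
    rw [← hm, ← hm, h0, inner_zero_left, inner_zero_left] at this
    exact lt_irrefl _ this
  refine ⟨‖m‖⁻¹ • m, by
    rw [norm_smul, norm_inv, norm_norm, inv_mul_cancel₀ (norm_ne_zero_iff.2 hm0)], fun z hz => ?_⟩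
  rw [real_inner_smul_left, inner_sub_right, hm, hm]
  exact mul_nonpos_of_nonneg_of_nonpos (by positivity) (by linarith [hf z hz])

/-- A supporting normal forms an obtuse angle with any direction that leads into the domain. -/
theorem IsSupportingNormal.inner_neg_of_mem {d : ℕ} {D : Set (Space d)} (hopen : IsOpen D)
    {y n s : Space d} (hn : IsSupportingNormal D y n) {r : ℝ} (hr : 0 < r)
    (hy : y + r • s ∈ D) : inner ℝ s n < 0 := by
  obtain ⟨ε, hε, hball⟩ := Metric.isOpen_iff.1 hopen _ hy
  -- Moving the interior point slightly along `n` stays in `D`; this makes the inequality strict.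
  have h1 := hn.2 (y + r • s + (ε / 2) • n) (hball (by
    rw [mem_ball, dist_eq_norm, add_sub_cancel_left, norm_smul, hn.1, mul_one,
      Real.norm_of_nonneg (by positivity)]
    linarith))
  rw [add_assoc, add_sub_cancel_left, inner_add_right, real_inner_smul_right,
    real_inner_smul_right, real_inner_self_eq_norm_sq, hn.1, real_inner_comm] at h1
  by_contra! h
  have := mul_nonneg hr.le h
  linarith

/-- The boundary points through which lines of direction `s` enter the domain are limits of
regular inflow points. -/
theorem mem_closure_fiberInflow {d : ℕ} {D : Set (Space d)} (hopen : IsOpen D)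
    (hconv : Convex ℝ D) (s : Directions d) {e : Space d} (he : e ∈ frontier D) {r : ℝ}
    (hr : 0 < r) (hers : e + r • (s : Space d) ∈ D) : e ∈ closure (fiberInflow D s) := by
  rw [Metric.mem_closure_iff]
  intro ε hε
  obtain ⟨η, hη, hball⟩ := Metric.isOpen_iff.1 hopen _ hers
  have heD : e ∉ D := by
    rw [hopen.frontier_eq] at he; exact he.2
  -- Let `y` be a point of the complement nearest to some `p ∈ D` close to `e`. The ball about `p`
  -- through `y` lies in `D`, so the normal at `y` is unique. The factor one half is there because
  -- `dist e y ≤ 2 * dist e p`; closeness within `η` keeps `y + r • s` in `D`.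
  obtain ⟨p, hpD, hp⟩ := Metric.mem_closure_iff.1 (frontier_subset_closure he)
    (min ε η / 2) (by positivity)
  obtain ⟨y, hy, hdist⟩ := hopen.isClosed_compl.exists_infDist_eq_dist ⟨e, heD⟩ p
  have hpy : p ≠ y := fun h => hy (h ▸ hpD)
  have hsub : ball p (dist p y) ⊆ D := by
    rw [← hdist]
    intro z hz
    by_contra hzD
    exact (infDist_le_dist_of_mem (show z ∈ Dᶜ from hzD)).not_gt (by rwa [dist_comm])
  have hpe : dist p y ≤ dist p e := hdist ▸ infDist_le_dist_of_mem (show e ∈ Dᶜ from heD)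
  have hye : dist e y < min ε η := by
    calc dist e y ≤ dist e p + dist p y := dist_triangle _ _ _
      _ ≤ dist e p + dist e p := by rw [dist_comm p e] at hpe; gcongr
      _ < min ε η := by linarith
  have hyfr : y ∈ frontier D := by
    rw [hopen.frontier_eq]
    refine ⟨closure_mono hsub ?_, hy⟩
    rw [closure_ball _ (dist_pos.2 hpy).ne', mem_closedBall, dist_comm]
  obtain ⟨n, hn⟩ := exists_isSupportingNormal hopen hconv ⟨p, hpD⟩ hy
  refine ⟨y, ⟨hyfr, n, ⟨hn, fun m hm => ?_⟩, hn.inner_neg_of_mem hopen hr (hball ?_)⟩,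
    hye.trans_le (min_le_left _ _)⟩
  · rw [hm.eq_of_ball_subset hpy hsub, hn.eq_of_ball_subset hpy hsub]
  · rw [mem_ball, dist_add_right, dist_comm]
    exact hye.trans_le (min_le_right _ _)

/-- A segment from a point outside of an open set to a point of the set meets the frontier before
it ends. -/
theorem exists_mem_frontier_of_notMem {d : ℕ} {D : Set (Space d)} (hopen : IsOpen D)
    {x s : Space d} {h : ℝ} (hh : 0 ≤ h) (hx : x ∉ D) (hxs : x + h • s ∈ D) :
    ∃ t, 0 ≤ t ∧ t < h ∧ x + t • s ∈ frontier D := by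
  have hc : Continuous fun t : ℝ => x + t • s := by fun_prop
  -- The last parameter at which the segment is outside `D` gives the frontier point.
  set A : Set ℝ := {t | t ∈ Set.Icc 0 h ∧ x + t • s ∉ D} with hA
  have hAc : IsCompact A :=
    isCompact_Icc.inter_right (hopen.isClosed_compl.preimage hc)
  obtain ⟨t, ht, hmax⟩ := hAc.exists_isMaxOn
    ⟨0, ⟨le_rfl, hh⟩, by simpa using hx⟩ continuous_id.continuousOn
  have hth : t < h := ht.1.2.lt_of_ne fun he => ht.2 (he ▸ hxs)
  refine ⟨t, ht.1.1, hth, ?_⟩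
  rw [hopen.frontier_eq]
  refine ⟨?_, ht.2⟩
  have hmem : t ∈ closure (Set.Ioo t h) := by
    rw [closure_Ioo hth.ne]; exact ⟨le_rfl, hth.le⟩
  refine map_mem_closure (f := fun t : ℝ => x + t • s) hc hmem fun r hr => ?_
  by_contra hrD
  exact (hmax ⟨⟨ht.1.1.trans hr.1.le, hr.2.le⟩, hrD⟩).not_gt hr.1

/-- A continuous function that vanishes on the inflow boundary vanishes where lines of direction
`s` enter the domain. -/
theorem exists_zero_before_entry {d : ℕ} {D : Set (Space d)} (hopen : IsOpen D)
    (hconv : Convex ℝ D) (s : Directions d) {φ : Space d → ℝ} (hφ : Continuous φ)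
    (hzero : ∀ x ∈ fiberInflow D s, φ x = 0) {x : Space d} {h : ℝ} (hh : 0 ≤ h) (hx : x ∉ D)
    (hxs : x + h • (s : Space d) ∈ D) :
    ∃ t, 0 ≤ t ∧ t < h ∧ φ (x + t • (s : Space d)) = 0 := by
  obtain ⟨t, h0, h1, h2⟩ := exists_mem_frontier_of_notMem hopen hh hx hxs
  refine ⟨t, h0, h1, ?_⟩
  have h3 : x + t • (s : Space d) ∈ closure (fiberInflow D s) := by
    refine mem_closure_fiberInflow hopen hconv s h2 (sub_pos.2 h1) ?_
    rwa [add_assoc, ← add_smul, add_sub_cancel]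
  exact closure_minimal (t := {x | φ x = 0}) hzero (isClosed_eq hφ continuous_const) h3

/-! ### The energy inequality on a fiber -/

theorem Directions.norm_eq {d : ℕ} (s : Directions d) : ‖(s : Space d)‖ = 1 := by
  simp

theorem integrableOn_of_subset_closedBall {d : ℕ} {D : Set (Space d)} {R : ℝ}
    (hR : D ⊆ closedBall 0 R) {f : Space d → ℝ} (hf : Continuous f) : IntegrableOn f D :=
  (hf.continuousOn.integrableOn_compact (isCompact_closedBall 0 R)).mono_set hR

theorem isFiniteMeasure_domainMeasure {d : ℕ} {D : Set (Space d)}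
    (hbdd : Bornology.IsBounded D) : IsFiniteMeasure (domainMeasure D) :=
  ⟨by rw [Measure.restrict_apply_univ]; exact hbdd.measure_lt_top⟩

/-- If `ψ` is non-negative in `D` and of size `O(h²)` at the points from which the domain is reached
by a step `h` in direction `s`, then `∫_D s · ∇ψ` is non-negative. -/
theorem integral_fderiv_nonneg_of_entry {d : ℕ} {D : Set (Space d)} (hopen : IsOpen D) {R : ℝ}
    (hR : D ⊆ closedBall 0 R) (s : Directions d) {ψ : Space d → ℝ} (hψ : ContDiff ℝ 1 ψ)
    (hpos : ∀ x ∈ D, 0 ≤ ψ x) {C : ℝ} (hC : 0 ≤ C)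
    (hentry : ∀ h : ℝ, 0 ≤ h → h ≤ 1 → ∀ x, x ∉ D → x + h • (s : Space d) ∈ D → ψ x ≤ C * h ^ 2) :
    0 ≤ ∫ x in D, fderiv ℝ ψ x s := by
  have hfin : IsFiniteMeasure ((volume : Measure (Space d)).restrict D) :=
    isFiniteMeasure_domainMeasure (isBounded_closedBall.subset hR)
  have hψ' : Continuous fun x => fderiv ℝ ψ x s :=
    (hψ.continuous_fderiv one_ne_zero).clm_apply continuous_const
  -- `G'(0) = -∫_D s · ∇ψ`, so an upper bound for the growth of `G` to the right of `0` suffices.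
  set G : ℝ → ℝ := fun h => ∫ x in D, ψ (x - h • (s : Space d)) with hG
  obtain ⟨K, hK⟩ := (isCompact_closedBall (0 : Space d) (R + 1)).exists_bound_of_continuousOn
    hψ'.continuousOn
  have hderiv : HasDerivAt G (∫ x in D, -fderiv ℝ ψ x s) 0 := by
    have h0 : ∫ x in D, -fderiv ℝ ψ x s =
        ∫ x in D, -fderiv ℝ ψ (x - (0 : ℝ) • (s : Space d)) s := by
      simp only [zero_smul, sub_zero]
    rw [h0]
    refine (hasDerivAt_integral_of_dominated_loc_of_deriv_le
      (F := fun (h : ℝ) (x : Space d) => ψ (x - h • (s : Space d)))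
      (F' := fun (h : ℝ) (x : Space d) => -fderiv ℝ ψ (x - h • (s : Space d)) s)
      (bound := fun _ => K) (ball_mem_nhds (0 : ℝ) one_pos) ?_ ?_ ?_ ?_ ?_ ?_).2
    · exact Filter.Eventually.of_forall fun h =>
        (hψ.continuous.comp (by fun_prop)).aestronglyMeasurable
    · exact integrableOn_of_subset_closedBall hR (hψ.continuous.comp (by fun_prop))
    · exact (hψ'.comp (by fun_prop : Continuous fun x : Space d =>
        x - (0 : ℝ) • (s : Space d))).neg.aestronglyMeasurable
    · refine (ae_restrict_iff' hopen.measurableSet).2 (Filter.Eventually.of_forall ?_)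
      intro x hx h hh
      rw [norm_neg]
      refine hK _ ?_
      rw [mem_closedBall_zero_iff]
      refine (norm_sub_le _ _).trans (add_le_add (mem_closedBall_zero_iff.1 (hR hx)) ?_)
      rw [norm_smul, Directions.norm_eq, mul_one]
      exact (mem_ball_zero_iff.1 hh).le
    · exact integrable_const _
    · refine Filter.Eventually.of_forall fun x h _ => ?_
      have h1 : HasDerivAt (fun h : ℝ => x - h • (s : Space d)) (-(s : Space d)) h := by
        simpa using ((hasDerivAt_id h).smul_const (s : Space d)).const_sub x
      have h2 := (hψ.differentiable one_ne_zero (x - h • (s : Space d))).hasFDerivAt.comp_hasDerivAt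
        h h1
      rw [map_neg] at h2
      exact h2
  -- After translation `G h` is the integral of `ψ` over `D - h s`. Compared with `D`, the points
  -- lost carry `ψ ≥ 0`, and the points gained are those of `hentry`, where `ψ` is at most `C * h ^
  -- 2`.
  have hbound : ∀ h : ℝ, 0 ≤ h → h ≤ 1 → G h ≤ G 0 + C * h ^ 2 * volume.real D := by
    intro h h0 h1
    have hGh : G h = ∫ x, D.indicator (fun y => ψ (y - h • (s : Space d))) (x + h • (s : Space d)) := by
      rw [integral_add_right_eq_self
        (fun x => D.indicator (fun y => ψ (y - h • (s : Space d))) x) (h • (s : Space d)),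
        integral_indicator hopen.measurableSet]
    have hG0 : G 0 = ∫ x, D.indicator ψ x := by
      rw [integral_indicator hopen.measurableSet]; simp [hG]
    have hvol : C * h ^ 2 * volume.real D =
        ∫ x, D.indicator (fun _ => C * h ^ 2) (x + h • (s : Space d)) := by
      rw [integral_add_right_eq_self
        (fun x => D.indicator (fun _ => C * h ^ 2) x) (h • (s : Space d)),
        integral_indicator hopen.measurableSet, setIntegral_const, smul_eq_mul, mul_comm]
    have i1 : Integrable fun x =>
        D.indicator (fun y => ψ (y - h • (s : Space d))) (x + h • (s : Space d)) :=
      ((integrable_indicator_iff hopen.measurableSet).2 (integrableOn_of_subset_closedBall hR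
        (hψ.continuous.comp (by fun_prop)))).comp_add_right _
    have i2 : Integrable (D.indicator ψ) := (integrable_indicator_iff hopen.measurableSet).2
      (integrableOn_of_subset_closedBall hR hψ.continuous)
    have i3 : Integrable fun x => D.indicator (fun _ => C * h ^ 2) (x + h • (s : Space d)) :=
      ((integrable_indicator_iff hopen.measurableSet).2 (integrableOn_of_subset_closedBall hR
        continuous_const)).comp_add_right _
    rw [hGh, hG0, hvol, ← integral_add i2 i3]
    refine integral_mono i1 (i2.add i3) fun x => ?_
    have hCh : 0 ≤ C * h ^ 2 := by positivity
    by_cases hx : x ∈ D <;> by_cases hxs : x + h • (s : Space d) ∈ D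
    · simpa [hx, hxs] using hCh
    · simpa [hx, hxs] using hpos x hx
    · simpa [hx, hxs] using hentry h h0 h1 x hx hxs
    · simp [hx, hxs]
  have hslope := (hasDerivAt_iff_tendsto_slope.1 hderiv).mono_left
    (nhdsWithin_mono (0 : ℝ) (fun h (hh : 0 < h) => hh.ne') :
      nhdsWithin (0 : ℝ) (Set.Ioi 0) ≤ nhdsWithin 0 {0}ᶜ)
  have hlim : Filter.Tendsto (fun h : ℝ => C * volume.real D * h) (nhdsWithin 0 (Set.Ioi 0))
      (nhds 0) := by
    have : Continuous fun h : ℝ => C * volume.real D * h := by fun_prop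
    simpa using (this.tendsto 0).mono_left nhdsWithin_le_nhds
  have hle : ∫ x in D, -fderiv ℝ ψ x s ≤ 0 := by
    refine le_of_tendsto_of_tendsto hslope hlim ?_
    filter_upwards [Ioo_mem_nhdsGT (zero_lt_one' ℝ)] with h hh
    rw [slope_def_field, sub_zero, div_le_iff₀ hh.1]
    have := hbound h hh.1.le hh.2.le
    linarith
  rw [integral_neg] at hle
  linarith

/-- The energy inequality for `C¹` functions that vanish on the inflow boundary. -/
theorem integral_sq_le_of_fiberInflow {d : ℕ} {D : Set (Space d)} (hopen : IsOpen D)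
    (hconv : Convex ℝ D) {R : ℝ} (hR : D ⊆ closedBall 0 R) (s : Directions d)
    {φ : Space d → ℝ} (hφ : ContDiff ℝ 1 φ) (hzero : ∀ x ∈ fiberInflow D s, φ x = 0) :
    ∫ x in D, φ x ^ 2 ≤
      2 * ∫ x in D, (R - inner ℝ (s : Space d) x) * φ x * fderiv ℝ φ x s := by
  rcases D.eq_empty_or_nonempty with rfl | ⟨x₀, hx₀⟩
  · simp
  have hR0 : 0 ≤ R := (norm_nonneg x₀).trans (mem_closedBall_zero_iff.1 (hR hx₀))
  have hin : ∀ x : Space d, |inner ℝ (s : Space d) x| ≤ ‖x‖ := fun x => by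
    simpa [Directions.norm_eq] using abs_real_inner_le_norm (s : Space d) x
  set ψ : Space d → ℝ := fun x => (R - inner ℝ (s : Space d) x) * φ x ^ 2 with hψdef
  have hψ : ContDiff ℝ 1 ψ :=
    (contDiff_const.sub (contDiff_const.inner ℝ contDiff_id)).mul (hφ.pow 2)
  have hψ' : ∀ x, fderiv ℝ ψ x s =
      2 * ((R - inner ℝ (s : Space d) x) * φ x * fderiv ℝ φ x s) - φ x ^ 2 := by
    intro x
    have h1 : HasFDerivAt (fun x : Space d => R - inner ℝ (s : Space d) x)
        (-innerSL ℝ (s : Space d)) x :=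
      (innerSL ℝ (s : Space d)).hasFDerivAt.const_sub R
    have h2 : HasFDerivAt ψ _ x := h1.mul ((hφ.differentiable one_ne_zero x).hasFDerivAt.pow 2)
    rw [h2.fderiv]
    simp only [add_apply, smul_apply,
      neg_apply, innerSL_apply_apply, real_inner_self_eq_norm_sq,
      Directions.norm_eq, smul_eq_mul, nsmul_eq_mul]
    push_cast
    ring
  -- Points that reach `D` by a step `h ≤ 1` lie in the ball of radius `R + 1`. There the weight is
  -- at most `2 * R + 1`, and `|φ| ≤ K * h` since `φ` has a zero within distance `h`; squaring gives
  -- the order `h ^ 2`.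
  obtain ⟨K, hK⟩ := hφ.contDiffOn.exists_lipschitzOnWith one_ne_zero
    (convex_closedBall (0 : Space d) (R + 1)) (isCompact_closedBall _ _)
  have hnonneg := integral_fderiv_nonneg_of_entry hopen hR s hψ (C := (2 * R + 1) * K ^ 2)
    (fun x hx => mul_nonneg (by
      have := hin x
      have := mem_closedBall_zero_iff.1 (hR hx)
      linarith [le_abs_self (inner ℝ (s : Space d) x)]) (sq_nonneg _)) (by positivity) (by
    intro h h0 h1 x hx hxs
    obtain ⟨t, ht0, hth, ht⟩ :=
      exists_zero_before_entry hopen hconv s hφ.continuous hzero h0 hx hxs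
    have hball : ∀ r, 0 ≤ r → r ≤ h → x + r • (s : Space d) ∈ closedBall 0 (R + 1) := by
      intro r hr0 hrh
      rw [mem_closedBall_zero_iff, show x + r • (s : Space d) =
        (x + h • (s : Space d)) - (h - r) • (s : Space d) by rw [sub_smul]; abel]
      refine (norm_sub_le _ _).trans (add_le_add (mem_closedBall_zero_iff.1 (hR hxs)) ?_)
      rw [norm_smul, Directions.norm_eq, mul_one, Real.norm_of_nonneg (by linarith)]
      linarith
    have hx0 : x ∈ closedBall (0 : Space d) (R + 1) := by simpa using hball 0 le_rfl h0
    have hl : |φ x| ≤ K * h := by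
      have := hK.dist_le_mul x hx0 _ (hball t ht0 hth.le)
      rw [ht, Real.dist_eq, sub_zero, dist_self_add_right, norm_smul, Directions.norm_eq, mul_one,
        Real.norm_of_nonneg ht0] at this
      exact this.trans (by gcongr)
    have h2 : φ x ^ 2 ≤ (K * h) ^ 2 := sq_le_sq' (by linarith [neg_abs_le (φ x)])
      (by linarith [le_abs_self (φ x)])
    have h3 : R - inner ℝ (s : Space d) x ≤ 2 * R + 1 := by
      have := hin x
      have := mem_closedBall_zero_iff.1 hx0
      linarith [neg_abs_le (inner ℝ (s : Space d) x)]
    calc ψ x ≤ (2 * R + 1) * (K * h) ^ 2 :=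
          (mul_le_mul_of_nonneg_right h3 (sq_nonneg _)).trans
            (mul_le_mul_of_nonneg_left h2 (by positivity))
      _ = (2 * R + 1) * K ^ 2 * h ^ 2 := by ring)
  have hφ' : Continuous fun x => fderiv ℝ φ x s :=
    (hφ.continuous_fderiv one_ne_zero).clm_apply continuous_const
  have hφc := hφ.continuous
  simp_rw [hψ'] at hnonneg
  rw [integral_sub, integral_const_mul] at hnonneg
  · linarith
  · exact integrableOn_of_subset_closedBall hR (by fun_prop)
  · exact integrableOn_of_subset_closedBall hR (by fun_prop)

/-! ### Ray integrals: solving the transport equation without absorption -/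

/-- Differentiation of an interval integral with respect to a parameter, for an integrand with
jointly continuous derivative. -/
theorem hasFDerivAt_intervalIntegral_of_continuous {E : Type*} [NormedAddCommGroup E]
    [NormedSpace ℝ E] [ProperSpace E] {F : E → ℝ → ℝ} {F' : E → ℝ → E →L[ℝ] ℝ}
    (hF : Continuous F.uncurry) (hF' : Continuous F'.uncurry)
    (hd : ∀ x t, HasFDerivAt (fun x => F x t) (F' x t) x) (a b : ℝ) (x : E) :
    HasFDerivAt (fun x => ∫ t in a..b, F x t) (∫ t in a..b, F' x t) x := by
  obtain ⟨K, hK⟩ := ((isCompact_closedBall x 1).prod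
    (isCompact_uIcc (a := a) (b := b))).exists_bound_of_continuousOn hF'.continuousOn
  refine intervalIntegral.hasFDerivAt_integral_of_dominated_of_fderiv_le (bound := fun _ => K)
    (closedBall_mem_nhds x one_pos) ?_ ?_ ?_ ?_ intervalIntegrable_const ?_
  · exact Filter.Eventually.of_forall fun y =>
      (hF.comp (Continuous.prodMk_right y)).aestronglyMeasurable
  · exact (hF.comp (Continuous.prodMk_right x)).intervalIntegrable a b
  · exact (hF'.comp (Continuous.prodMk_right x)).aestronglyMeasurable
  · exact Filter.Eventually.of_forall fun t ht y hy =>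
      hK (y, t) ⟨hy, Set.uIoc_subset_uIcc ht⟩
  · exact Filter.Eventually.of_forall fun t _ y _ => hd y t

/-- The linear shear `(x, y) ↦ (x - r y, y)`. -/
def shear (d : ℕ) (r : ℝ) : Space d × Space d →L[ℝ] Space d × Space d :=
  ContinuousLinearMap.id ℝ _ -
    r • (ContinuousLinearMap.inl ℝ (Space d) (Space d)).comp (ContinuousLinearMap.snd ℝ _ _)

theorem shear_apply {d : ℕ} (r : ℝ) (z : Space d × Space d) :
    shear d r z = (z.1 - r • z.2, z.2) := by
  simp [shear, Prod.ext_iff]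

theorem continuous_shear (d : ℕ) : Continuous (shear d) := by
  unfold shear
  fun_prop

/-- The integral of `G(·, y)` along the segment of length `L` from `x` in direction `-y`. -/
def rayIntegral {d : ℕ} (G : Space d × Space d → ℝ) (L : ℝ) (z : Space d × Space d) : ℝ :=
  ∫ r in (0 : ℝ)..L, G (shear d r z)

theorem hasFDerivAt_rayIntegral {d : ℕ} {G : Space d × Space d → ℝ} (hG : ContDiff ℝ 1 G)
    (L : ℝ) (z : Space d × Space d) :
    HasFDerivAt (rayIntegral G L)
      (∫ r in (0 : ℝ)..L, (fderiv ℝ G (shear d r z)).comp (shear d r)) z := by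
  have hs : Continuous fun q : (Space d × Space d) × ℝ => shear d q.2 q.1 :=
    ((continuous_shear d).comp continuous_snd).clm_apply continuous_fst
  refine hasFDerivAt_intervalIntegral_of_continuous (F := fun z r => G (shear d r z))
    (F' := fun z r => (fderiv ℝ G (shear d r z)).comp (shear d r)) (hG.continuous.comp hs)
    (((hG.continuous_fderiv one_ne_zero).comp hs).clm_comp
      ((continuous_shear d).comp continuous_snd)) (fun z r => ?_) 0 L z
  exact (hG.differentiable one_ne_zero _).hasFDerivAt.comp z (shear d r).hasFDerivAt

theorem continuous_fderiv_rayIntegrand {d : ℕ} {G : Space d × Space d → ℝ}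
    (hG : ContDiff ℝ 1 G) : Continuous fun q : (Space d × Space d) × ℝ =>
      (fderiv ℝ G (shear d q.2 q.1)).comp (shear d q.2) :=
  ((hG.continuous_fderiv one_ne_zero).comp
    (((continuous_shear d).comp continuous_snd).clm_apply continuous_fst)).clm_comp
      ((continuous_shear d).comp continuous_snd)

theorem contDiff_rayIntegral {d : ℕ} {G : Space d × Space d → ℝ} (hG : ContDiff ℝ 1 G)
    (L : ℝ) : ContDiff ℝ 1 (rayIntegral G L) :=
  contDiff_one_iff_hasFDerivAt.2 ⟨_,
    intervalIntegral.continuous_parametric_intervalIntegral_of_continuous'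
      (continuous_fderiv_rayIntegrand hG) 0 L, hasFDerivAt_rayIntegral hG L⟩

theorem hasDerivAt_neg_comp {V : Type*} [NormedAddCommGroup V] [NormedSpace ℝ V] {G : V → ℝ}
    (hG : Differentiable ℝ G) {c : ℝ → V} {v w : V} {r : ℝ} (hc : HasDerivAt c w r)
    (hw : w = -v) : HasDerivAt (fun r => -G (c r)) (fderiv ℝ G (c r) v) r := by
  subst hw
  have h : HasDerivAt (fun r => G (c r)) (fderiv ℝ G (c r) (-v)) r :=
    (hG (c r)).hasFDerivAt.comp_hasDerivAt r hc
  simpa only [map_neg, neg_neg] using h.fun_neg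

theorem hasDerivAt_shear {d : ℕ} (z : Space d × Space d) (r : ℝ) :
    HasDerivAt (fun r : ℝ => shear d r z) (-z.2, 0) r := by
  have h : HasDerivAt (fun r : ℝ => z.1 - r • z.2) (-z.2) r := by
    simpa using ((hasDerivAt_id r).smul_const z.2).const_sub z.1
  simp_rw [shear_apply]
  exact h.prodMk (hasDerivAt_const r z.2)

theorem hasDerivAt_neg_comp_shear {d : ℕ} {G : Space d × Space d → ℝ} (hG : ContDiff ℝ 1 G)
    (z : Space d × Space d) (r : ℝ) :
    HasDerivAt (fun r => -G (shear d r z)) (fderiv ℝ G (shear d r z) (z.2, 0)) r :=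
  hasDerivAt_neg_comp (hG.differentiable one_ne_zero) (hasDerivAt_shear z r) (by simp)

/-- Along the ray the integrand is the derivative of `r ↦ -G (shear d r z)`, so only the end points
remain. -/
theorem integral_fderiv_shear {d : ℕ} {G : Space d × Space d → ℝ} (hG : ContDiff ℝ 1 G)
    (L : ℝ) (z : Space d × Space d) :
    ∫ r in (0 : ℝ)..L, fderiv ℝ G (shear d r z) (z.2, 0) = G z - G (z.1 - L • z.2, z.2) := by
  have hs : Continuous fun r => shear d r z := (continuous_shear d).clm_apply continuous_const
  have hc : Continuous fun r => fderiv ℝ G (shear d r z) (z.2, 0) :=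
    ((hG.continuous_fderiv one_ne_zero).comp hs).clm_apply continuous_const
  rw [intervalIntegral.integral_eq_sub_of_hasDerivAt
    (fun r _ => hasDerivAt_neg_comp_shear hG z r) (hc.intervalIntegrable 0 L)]
  simp only [shear_apply, zero_smul, sub_zero]
  ring

/-- The derivative of the ray integral in the direction of the ray. -/
theorem fderiv_rayIntegral {d : ℕ} {G : Space d × Space d → ℝ} (hG : ContDiff ℝ 1 G)
    (L : ℝ) (z : Space d × Space d) :
    fderiv ℝ (rayIntegral G L) z (z.2, 0) = G z - G (z.1 - L • z.2, z.2) := by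
  have hc : Continuous fun r => (fderiv ℝ G (shear d r z)).comp (shear d r) :=
    (continuous_fderiv_rayIntegrand hG).comp (Continuous.prodMk_right z)
  rw [(hasFDerivAt_rayIntegral hG L z).fderiv,
    ContinuousLinearMap.intervalIntegral_apply (hc.intervalIntegrable 0 L),
    ← integral_fderiv_shear hG]
  congr 1
  funext r
  rw [ContinuousLinearMap.comp_apply, shear_apply r (z.2, 0), smul_zero, sub_zero]

/-- Going backwards from an inflow point leads to the side of the supporting hyperplane that does
not meet `D`. For `r = 0` the point itself is outside `D` because `D` is open. -/
theorem inflow_ray_notMem {d : ℕ} {D : Set (Space d)} (hopen : IsOpen D) {s x : Space d}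
    (hx : x ∈ frontier D) {n : Space d} (hn : IsSupportingNormal D x n) (hsn : inner ℝ s n < 0)
    {r : ℝ} (hr : 0 ≤ r) : x - r • s ∉ D := by
  rcases hr.eq_or_lt with rfl | hr
  · rw [zero_smul, sub_zero]
    rw [hopen.frontier_eq] at hx
    exact hx.2
  · intro h
    have := hn.2 _ h
    rw [sub_sub_cancel_left, inner_neg_right, real_inner_smul_right, real_inner_comm] at this
    linarith [mul_neg_of_pos_of_neg hr hsn]

theorem rayIntegral_eq_zero_of_inflow {d : ℕ} {D : Set (Space d)} (hopen : IsOpen D)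
    {G : Space d × Space d → ℝ} (hG0 : ∀ z, z.1 ∉ D → G z = 0) {L : ℝ} (hL : 0 ≤ L)
    {s x : Space d} (hx : x ∈ frontier D) {n : Space d} (hn : IsSupportingNormal D x n)
    (hsn : inner ℝ s n < 0) : rayIntegral G L (x, s) = 0 := by
  refine intervalIntegral.integral_zero_ae (Filter.Eventually.of_forall fun r hr => ?_)
  rw [Set.uIoc_of_le hL] at hr
  rw [shear_apply]
  exact hG0 _ (inflow_ray_notMem hopen hx hn hsn hr.1.le)

/-- Inside the domain the ray integral along sufficiently long rays solves the transport
equation with right-hand side `G`. -/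
theorem fderiv_rayIntegral_of_mem {d : ℕ} {D : Set (Space d)} {R : ℝ} (hR : D ⊆ closedBall 0 R)
    {G : Space d × Space d → ℝ} (hG : ContDiff ℝ 1 G) (hG0 : ∀ z, z.1 ∉ D → G z = 0)
    {x : Space d} (hx : x ∈ D) (s : Directions d) :
    fderiv ℝ (rayIntegral G (2 * R + 1)) (x, (s : Space d)) ((s : Space d), 0) =
      G (x, (s : Space d)) := by
  rw [fderiv_rayIntegral hG (2 * R + 1) (x, (s : Space d))]
  have hxR : ‖x‖ ≤ R := mem_closedBall_zero_iff.1 (hR hx)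
  have hR0 : 0 ≤ R := (norm_nonneg x).trans hxR
  -- The length `2 * R + 1` exceeds the diameter of the ball containing `D`, so the far end of the
  -- ray lies outside `D`.
  rw [hG0 (x - (2 * R + 1) • (s : Space d), (s : Space d)), sub_zero]
  intro h
  have h1 : ‖x - (2 * R + 1) • (s : Space d)‖ ≤ R := mem_closedBall_zero_iff.1 (hR h)
  have h2 : ‖(2 * R + 1) • (s : Space d)‖ = 2 * R + 1 := by
    rw [norm_smul, Directions.norm_eq, mul_one, Real.norm_of_nonneg (by positivity)]
  have h3 := norm_sub_norm_le ((2 * R + 1) • (s : Space d)) x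
  rw [h2, norm_sub_rev] at h3
  linarith

/-! ### Integration by parts, completeness and `C¹` elements of the graph spaces -/

/-- The derivative of a slice. -/
theorem fderiv_slice {d : ℕ} {φ : Space d × Space d → ℝ} (hφ : ContDiff ℝ 1 φ) (x y v : Space d) :
    fderiv ℝ (fun x => φ (x, y)) x v = fderiv ℝ φ (x, y) (v, 0) := by
  have h : HasFDerivAt (fun x => φ (x, y)) _ x :=
    (hφ.differentiable one_ne_zero (x, y)).hasFDerivAt.comp x (hasFDerivAt_prodMk_left x y)
  rw [h.fderiv]
  rfl

theorem contDiff_slice {d : ℕ} {n : WithTop ℕ∞} {φ : Space d × Space d → ℝ} (hφ : ContDiff ℝ n φ)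
    (y : Space d) : ContDiff ℝ n fun x => φ (x, y) :=
  hφ.comp (contDiff_id.prodMk contDiff_const)

/-- Integration by parts in a domain against a compactly supported function. -/
theorem setIntegral_mul_fderiv {d : ℕ} {D : Set (Space d)} {φ χ : Space d → ℝ}
    (hφ : ContDiff ℝ 1 φ) (hχ : ContDiff ℝ 1 χ) (hc : HasCompactSupport χ)
    (hsupp : tsupport χ ⊆ D) (s : Space d) :
    ∫ x in D, φ x * fderiv ℝ χ x s = -∫ x in D, fderiv ℝ φ x s * χ x := by
  have hφ' : Continuous fun x => fderiv ℝ φ x s :=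
    (hφ.continuous_fderiv one_ne_zero).clm_apply continuous_const
  have hχ' : Continuous fun x => fderiv ℝ χ x s :=
    (hχ.continuous_fderiv one_ne_zero).clm_apply continuous_const
  have h1 : ∀ x ∉ D, χ x = 0 := fun x hx => image_eq_zero_of_notMem_tsupport fun h => hx (hsupp h)
  have h2 : ∀ x ∉ D, fderiv ℝ χ x = 0 := fun x hx =>
    Function.notMem_support.1 fun h => hx (hsupp (support_fderiv_subset ℝ h))
  -- Both integrands vanish off `D`, so the integrals extend to the whole space and no boundary term
  -- arises.
  rw [setIntegral_eq_integral_of_forall_compl_eq_zero fun x hx => by rw [h2 x hx]; simp,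
    setIntegral_eq_integral_of_forall_compl_eq_zero fun x hx => by rw [h1 x hx, mul_zero]]
  refine integral_mul_fderiv_eq_neg_fderiv_mul_of_integrable ?_ ?_ ?_
    (fun x _ => hφ.differentiable one_ne_zero x) (fun x _ => hχ.differentiable one_ne_zero x)
  · exact (hφ'.mul hχ.continuous).integrable_of_hasCompactSupport hc.mul_left
  · exact (hφ.continuous.mul hχ').integrable_of_hasCompactSupport
      (hc.fderiv_apply ℝ s).mul_left
  · exact (hφ.continuous.mul hχ.continuous).integrable_of_hasCompactSupport hc.mul_left

theorem continuous_integral_mul {α : Type*} [MeasurableSpace α] {μ : Measure α} {g : α → ℝ}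
    (hg : MemLp g 2 μ) : Continuous fun v : Lp ℝ 2 μ => ∫ x, v x * g x ∂μ := by
  have h : (fun v : Lp ℝ 2 μ => ∫ x, v x * g x ∂μ) = fun v => inner ℝ v (hg.toLp g) := by
    funext v
    rw [inner_eq_integral_mul]
    refine integral_congr_ae ?_
    filter_upwards [hg.coeFn_toLp] with x hx
    rw [hx]
  rw [h]
  exact continuous_id.inner continuous_const

/-- Each test function imposes an equality of two continuous functionals of the pair. Closedness
supplies the completeness needed for closed range. -/
theorem isClosed_fiberSpace {d : ℕ} (D : Set (Space d)) (s : Directions d) :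
    IsClosed (fiberSpace D s : Set (WithLp 2 (L2Domain D × L2Domain D))) := by
  change IsClosed {p : WithLp 2 (L2Domain D × L2Domain D) | ∀ φ : Space d → ℝ, _}
  simp only [Set.ofPred_forall]
  refine isClosed_iInter fun φ => isClosed_iInter fun h1 => isClosed_iInter fun h2 =>
    isClosed_iInter fun _ => isClosed_eq ?_ ?_
  · exact (continuous_integral_mul (memLp_test_deriv h1 h2 s)).comp
      (WithLp.fstL 2 ℝ (L2Domain D) (L2Domain D)).continuous
  · exact ((continuous_integral_mul (memLp_test h1 h2)).comp
      (WithLp.sndL 2 ℝ (L2Domain D) (L2Domain D)).continuous).neg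

theorem isClosed_phaseSpace {d : ℕ} (D : Set (Space d)) :
    IsClosed (phaseSpace D : Set (WithLp 2 (L2Phase D × L2Phase D))) := by
  change IsClosed {p : WithLp 2 (L2Phase D × L2Phase D) | ∀ φ : Space d × Space d → ℝ, _}
  simp only [Set.ofPred_forall]
  refine isClosed_iInter fun φ => isClosed_iInter fun h1 => isClosed_iInter fun h2 =>
    isClosed_iInter fun _ => isClosed_eq ?_ ?_
  · exact (continuous_integral_mul (memLp_phaseTest_deriv h1 h2)).comp
      (WithLp.fstL 2 ℝ (L2Phase D) (L2Phase D)).continuous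
  · exact ((continuous_integral_mul (memLp_phaseTest h1 h2)).comp
      (WithLp.sndL 2 ℝ (L2Phase D) (L2Phase D)).continuous).neg

theorem memLp_of_subset_closedBall {d : ℕ} {D : Set (Space d)} (hopen : IsOpen D) {R : ℝ}
    (hR : D ⊆ closedBall 0 R) {f : Space d → ℝ} (hf : Continuous f) :
    MemLp f 2 (domainMeasure D) := by
  have := isFiniteMeasure_domainMeasure (isBounded_closedBall.subset hR)
  obtain ⟨K, hK⟩ := (isCompact_closedBall (0 : Space d) R).exists_bound_of_continuousOn
    hf.continuousOn
  refine MemLp.of_bound hf.aestronglyMeasurable K ?_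
  filter_upwards [ae_restrict_mem hopen.measurableSet] with x hx
  exact hK x (hR hx)

theorem ae_phaseMeasure_mem {d : ℕ} {D : Set (Space d)} (hopen : IsOpen D) :
    ∀ᵐ z ∂(phaseMeasure D), z.1 ∈ D :=
  Measure.quasiMeasurePreserving_fst.ae (ae_restrict_mem hopen.measurableSet)

theorem isFiniteMeasure_phaseMeasure {d : ℕ} {D : Set (Space d)} {R : ℝ}
    (hR : D ⊆ closedBall 0 R) : IsFiniteMeasure (phaseMeasure D) := by
  have := isFiniteMeasure_domainMeasure (isBounded_closedBall.subset hR)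
  infer_instance

theorem memLp_phase_of_subset_closedBall {d : ℕ} {D : Set (Space d)} (hopen : IsOpen D) {R : ℝ}
    (hR : D ⊆ closedBall 0 R) {f : Space d × Directions d → ℝ} (hf : Continuous f) :
    MemLp f 2 (phaseMeasure D) := by
  have := isFiniteMeasure_phaseMeasure hR
  obtain ⟨K, hK⟩ := ((isCompact_closedBall (0 : Space d) R).prod
    (isCompact_univ (X := Directions d))).exists_bound_of_continuousOn hf.continuousOn
  refine MemLp.of_bound hf.aestronglyMeasurable K ?_
  filter_upwards [ae_phaseMeasure_mem hopen] with z hz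
  exact hK z ⟨hR hz, Set.mem_univ _⟩

theorem integrable_phase_of_subset_closedBall {d : ℕ} {D : Set (Space d)} (hopen : IsOpen D)
    {R : ℝ} (hR : D ⊆ closedBall 0 R) {f : Space d × Directions d → ℝ} (hf : Continuous f) :
    Integrable f (phaseMeasure D) := by
  have := isFiniteMeasure_phaseMeasure hR
  exact (memLp_phase_of_subset_closedBall hopen hR hf).integrable (by norm_num)

theorem continuous_phase_fderiv {d : ℕ} {φ : Space d × Space d → ℝ} (hφ : ContDiff ℝ 1 φ) :
    Continuous fun z : Space d × Directions d =>
      fderiv ℝ φ (z.1, (z.2 : Space d)) ((z.2 : Space d), 0) :=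
  ((hφ.continuous_fderiv one_ne_zero).comp (isClosedEmbedding_phase d).continuous).clm_apply
    (by fun_prop)

theorem continuous_phase {d : ℕ} {φ : Space d × Space d → ℝ} (hφ : ContDiff ℝ 1 φ) :
    Continuous fun z : Space d × Directions d => φ (z.1, (z.2 : Space d)) :=
  hφ.continuous.comp (isClosedEmbedding_phase d).continuous

/-- Every `C¹` function that vanishes on `Γ₋(s)` defines an element of `fiberC1`. -/
theorem exists_mem_fiberC1 {d : ℕ} {D : Set (Space d)} (hopen : IsOpen D) {R : ℝ}
    (hR : D ⊆ closedBall 0 R) (s : Directions d) {φ : Space d → ℝ} (hφ : ContDiff ℝ 1 φ)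
    (hzero : ∀ x ∈ fiberInflow D s, φ x = 0) :
    ∃ p ∈ fiberC1 D s, p.1.snd =ᵐ[domainMeasure D] fun x => fderiv ℝ φ x s := by
  have h1 := memLp_of_subset_closedBall hopen hR hφ.continuous
  have h2 := memLp_of_subset_closedBall hopen hR
    ((hφ.continuous_fderiv one_ne_zero).clm_apply (continuous_const (y := (s : Space d))))
  have hmem : WithLp.toLp 2 (h1.toLp _, h2.toLp _) ∈ fiberSpace D s := by
    intro χ k1 k2 k3
    have e1 := h1.coeFn_toLp
    have e2 := h2.coeFn_toLp
    calc ∫ x, h1.toLp _ x * fderiv ℝ χ x s ∂(domainMeasure D)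
        = ∫ x, φ x * fderiv ℝ χ x s ∂(domainMeasure D) := by
          refine integral_congr_ae ?_
          filter_upwards [e1] with x hx
          rw [hx]
      _ = -∫ x, fderiv ℝ φ x s * χ x ∂(domainMeasure D) :=
          setIntegral_mul_fderiv hφ (k1.of_le (by simp)) k2 k3 s
      _ = -∫ x, h2.toLp _ x * χ x ∂(domainMeasure D) := by
          congr 1
          refine integral_congr_ae ?_
          filter_upwards [e2] with x hx
          rw [hx]
  exact ⟨⟨_, hmem⟩, ⟨φ, hφ, hzero, h1.coeFn_toLp, h2.coeFn_toLp⟩, h2.coeFn_toLp⟩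

/-- By Fubini it is enough to integrate by parts in `x` for each fixed direction, as the transport
derivative involves no derivative in `s`. -/
theorem integral_phase_mul_fderiv {d : ℕ} {D : Set (Space d)} (hopen : IsOpen D) {R : ℝ}
    (hR : D ⊆ closedBall 0 R) {φ χ : Space d × Space d → ℝ} (hφ : ContDiff ℝ 1 φ)
    (hχ : ContDiff ℝ 1 χ) (hc : HasCompactSupport χ) (hsupp : tsupport χ ⊆ D ×ˢ Set.univ) :
    ∫ z, φ (z.1, (z.2 : Space d)) * fderiv ℝ χ (z.1, (z.2 : Space d)) ((z.2 : Space d), 0)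
        ∂(phaseMeasure D) =
      -∫ z, fderiv ℝ φ (z.1, (z.2 : Space d)) ((z.2 : Space d), 0) * χ (z.1, (z.2 : Space d))
        ∂(phaseMeasure D) := by
  have := isFiniteMeasure_domainMeasure (isBounded_closedBall.subset hR)
  have i1 : Integrable (fun z : Space d × Directions d => φ (z.1, (z.2 : Space d)) *
      fderiv ℝ χ (z.1, (z.2 : Space d)) ((z.2 : Space d), 0)) (phaseMeasure D) :=
    integrable_phase_of_subset_closedBall hopen hR
      ((continuous_phase hφ).mul (continuous_phase_fderiv hχ))
  have i2 : Integrable (fun z : Space d × Directions d =>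
      fderiv ℝ φ (z.1, (z.2 : Space d)) ((z.2 : Space d), 0) * χ (z.1, (z.2 : Space d)))
      (phaseMeasure D) :=
    integrable_phase_of_subset_closedBall hopen hR
      ((continuous_phase_fderiv hφ).mul (continuous_phase hχ))
  rw [integral_prod_symm _ i1, integral_prod_symm _ i2, ← integral_neg]
  congr 1
  funext s
  simp only [← fderiv_slice hφ, ← fderiv_slice hχ]
  have hemb : Topology.IsClosedEmbedding fun x : Space d => (x, (s : Space d)) :=
    .of_continuous_injective_isClosedMap (by fun_prop) (Prod.mk_left_injective _)
      (isClosedMap_prodMk_right _)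
  refine setIntegral_mul_fderiv (contDiff_slice hφ _) (contDiff_slice hχ _)
    (hc.comp_isClosedEmbedding hemb) ?_ _
  intro x hx
  exact (hsupp (tsupport_comp_subset_preimage χ hemb.continuous hx)).1

/-- Every `C¹` function that vanishes on `Γ₋` defines an element of `phaseC1`. -/
theorem exists_mem_phaseC1 {d : ℕ} {D : Set (Space d)} (hopen : IsOpen D) {R : ℝ}
    (hR : D ⊆ closedBall 0 R) {φ : Space d × Space d → ℝ} (hφ : ContDiff ℝ 1 φ)
    (hzero : ∀ z ∈ phaseInflow D, φ (z.1, (z.2 : Space d)) = 0) :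
    ∃ p ∈ phaseC1 D, p.1.snd =ᵐ[phaseMeasure D] fun z =>
      fderiv ℝ φ (z.1, (z.2 : Space d)) ((z.2 : Space d), 0) := by
  have h1 := memLp_phase_of_subset_closedBall hopen hR (continuous_phase hφ)
  have h2 := memLp_phase_of_subset_closedBall hopen hR (continuous_phase_fderiv hφ)
  have hmem : WithLp.toLp 2 (h1.toLp _, h2.toLp _) ∈ phaseSpace D := by
    intro χ k1 k2 k3
    have e1 := h1.coeFn_toLp
    have e2 := h2.coeFn_toLp
    calc ∫ z, h1.toLp _ z * fderiv ℝ χ (z.1, (z.2 : Space d)) ((z.2 : Space d), 0)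
          ∂(phaseMeasure D)
        = ∫ z, φ (z.1, (z.2 : Space d)) *
            fderiv ℝ χ (z.1, (z.2 : Space d)) ((z.2 : Space d), 0) ∂(phaseMeasure D) := by
          refine integral_congr_ae ?_
          filter_upwards [e1] with x hx
          rw [hx]
      _ = -∫ z, fderiv ℝ φ (z.1, (z.2 : Space d)) ((z.2 : Space d), 0) *
            χ (z.1, (z.2 : Space d)) ∂(phaseMeasure D) :=
          integral_phase_mul_fderiv hopen hR hφ (k1.of_le (by simp)) k2 k3
      _ = -∫ z, h2.toLp _ z * χ (z.1, (z.2 : Space d)) ∂(phaseMeasure D) := by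
          congr 1
          refine integral_congr_ae ?_
          filter_upwards [e2] with x hx
          rw [hx]
  exact ⟨⟨_, hmem⟩, ⟨φ, hφ, hzero, h1.coeFn_toLp, h2.coeFn_toLp⟩, h2.coeFn_toLp⟩

/-! ### Density of the transport derivatives and energy inequalities in `L₂` -/

/-- The directional derivatives of the functions in `fiberC1` are dense in `L₂(D)`. -/
theorem eq_zero_of_orthogonal_fiberC1 {d : ℕ} {D : Set (Space d)} (hopen : IsOpen D) {R : ℝ}
    (hR0 : 0 ≤ R) (hR : D ⊆ closedBall 0 R) (s : Directions d) (f : L2Domain D)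
    (hf : ∀ p ∈ fiberC1 D s, ∫ x, p.1.snd x * f x ∂(domainMeasure D) = 0) : f = 0 := by
  have := isFiniteMeasure_domainMeasure (isBounded_closedBall.subset hR)
  have hloc : LocallyIntegrableOn f D (domainMeasure D) :=
    ((Lp.memLp f).integrable (by norm_num)).locallyIntegrable.locallyIntegrableOn D
  have key := hopen.ae_eq_zero_of_integral_contDiff_smul_eq_zero hloc (by
    intro g hg _ hsupp
    -- The test function is made constant in the second variable, so that the ray integral on `ℝ^d ×
    -- ℝ^d` serves both settings.
    have hG : ContDiff ℝ 1 fun z : Space d × Space d => g z.1 :=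
      (hg.of_le (by simp)).comp contDiff_fst
    have hG0 : ∀ z : Space d × Space d, z.1 ∉ D → g z.1 = 0 := fun z hz =>
      image_eq_zero_of_notMem_tsupport fun h => hz (hsupp h)
    have hray := contDiff_rayIntegral hG (2 * R + 1)
    obtain ⟨p, hp, hps⟩ := exists_mem_fiberC1 hopen hR s (contDiff_slice hray s)
      (fun x hx => by
        obtain ⟨hfr, n, hn, hsn⟩ := hx
        exact rayIntegral_eq_zero_of_inflow hopen hG0 (by positivity) hfr hn.1 hsn)
    rw [← hf p hp]
    refine integral_congr_ae ?_
    filter_upwards [hps, ae_restrict_mem hopen.measurableSet] with x hx hxD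
    rw [hx, fderiv_slice hray, fderiv_rayIntegral_of_mem hR hG hG0 hxD s, smul_eq_mul])
  rw [Lp.eq_zero_iff_ae_eq_zero]
  filter_upwards [key, ae_restrict_mem hopen.measurableSet] with x hx hxD
  exact hx hxD

/-- The transport derivatives of the functions in `phaseC1` are dense in `L₂(D × S)`. -/
theorem eq_zero_of_orthogonal_phaseC1 {d : ℕ} {D : Set (Space d)} (hopen : IsOpen D) {R : ℝ}
    (hR0 : 0 ≤ R) (hR : D ⊆ closedBall 0 R) (f : L2Phase D)
    (hf : ∀ p ∈ phaseC1 D, ∫ z, p.1.snd z * f z ∂(phaseMeasure D) = 0) : f = 0 := by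
  have := isFiniteMeasure_phaseMeasure hR
  set e : Space d × Directions d → Space d × Space d := fun z => (z.1, (z.2 : Space d)) with he
  have hemb : MeasurableEmbedding e := (isClosedEmbedding_phase d).measurableEmbedding
  -- The fundamental lemma with smooth test functions is applied in `ℝ^d × ℝ^d` to the pushforward
  -- of the phase measure. The value `0` off the image of `e` plays no role, as that measure lives
  -- on the image.
  set F : Space d × Space d → ℝ := Function.extend e f 0 with hF
  have hFe : ∀ z, F (e z) = f z := fun z => hemb.injective.extend_apply _ _ z
  have hint : Integrable F (Measure.map e (phaseMeasure D)) := by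
    rw [hemb.integrable_map_iff]
    have : F ∘ e = f := funext hFe
    rw [this]
    exact (Lp.memLp f).integrable (by norm_num)
  have hU : IsOpen (D ×ˢ (Set.univ : Set (Space d))) := hopen.prod isOpen_univ
  have key := hU.ae_eq_zero_of_integral_contDiff_smul_eq_zero
    (hint.locallyIntegrable.locallyIntegrableOn _) (by
    intro G hG' _ hsupp
    have hG : ContDiff ℝ 1 G := hG'.of_le (by simp)
    have hG0 : ∀ z : Space d × Space d, z.1 ∉ D → G z = 0 := fun z hz =>
      image_eq_zero_of_notMem_tsupport fun h => hz (hsupp h).1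
    have hray := contDiff_rayIntegral hG (2 * R + 1)
    obtain ⟨p, hp, hps⟩ := exists_mem_phaseC1 hopen hR hray
      (fun z hz => by
        obtain ⟨hfr, n, hn, hsn⟩ := hz
        exact rayIntegral_eq_zero_of_inflow hopen hG0 (by positivity) hfr hn.1 hsn)
    rw [hemb.integral_map, ← hf p hp]
    refine integral_congr_ae ?_
    filter_upwards [hps, ae_phaseMeasure_mem hopen] with z hz hzD
    rw [hz, fderiv_rayIntegral_of_mem hR hG hG0 hzD z.2, smul_eq_mul, hFe])
  rw [hemb.ae_map_iff] at key
  rw [Lp.eq_zero_iff_ae_eq_zero]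
  filter_upwards [key, ae_phaseMeasure_mem hopen] with z hz hzD
  rw [← hFe]
  exact hz ⟨hzD, Set.mem_univ _⟩

theorem energy_fiberC1 {d : ℕ} {D : Set (Space d)} (hopen : IsOpen D) (hconv : Convex ℝ D)
    {R : ℝ} (hR : D ⊆ closedBall 0 R) (s : Directions d) {p : fiberSpace D s}
    (hp : p ∈ fiberC1 D s) :
    ∫ x, p.1.fst x ^ 2 ∂(domainMeasure D) ≤
      2 * ∫ x, (R - inner ℝ (s : Space d) x) * p.1.fst x * p.1.snd x ∂(domainMeasure D) := by
  obtain ⟨φ, hφ, hzero, h1, h2⟩ := hp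
  have e1 : ∫ x, p.1.fst x ^ 2 ∂(domainMeasure D) = ∫ x in D, φ x ^ 2 := by
    refine integral_congr_ae ?_
    filter_upwards [h1] with x hx
    rw [hx]
  have e2 : ∫ x, (R - inner ℝ (s : Space d) x) * p.1.fst x * p.1.snd x ∂(domainMeasure D) =
      ∫ x in D, (R - inner ℝ (s : Space d) x) * φ x * fderiv ℝ φ x s := by
    refine integral_congr_ae ?_
    filter_upwards [h1, h2] with x hx hx'
    rw [hx, hx']
  rw [e1, e2]
  exact integral_sq_le_of_fiberInflow hopen hconv hR s hφ hzero

/-- Each slice of a `C¹` function vanishing on `Γ₋` vanishes on `Γ₋(s)`, so the fiber inequality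
holds for every `s` with the same `R` and can be integrated over `s`. -/
theorem energy_phaseC1 {d : ℕ} {D : Set (Space d)} (hopen : IsOpen D) (hconv : Convex ℝ D)
    {R : ℝ} (hR : D ⊆ closedBall 0 R) {p : phaseSpace D} (hp : p ∈ phaseC1 D) :
    ∫ z, p.1.fst z ^ 2 ∂(phaseMeasure D) ≤
      2 * ∫ z, (R - inner ℝ (z.2 : Space d) z.1) * p.1.fst z * p.1.snd z ∂(phaseMeasure D) := by
  have := isFiniteMeasure_domainMeasure (isBounded_closedBall.subset hR)
  obtain ⟨φ, hφ, hzero, h1, h2⟩ := hp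
  have e1 : ∫ z, p.1.fst z ^ 2 ∂(phaseMeasure D) =
      ∫ z, φ (z.1, (z.2 : Space d)) ^ 2 ∂(phaseMeasure D) := by
    refine integral_congr_ae ?_
    filter_upwards [h1] with x hx
    rw [hx]
  have e2 : ∫ z, (R - inner ℝ (z.2 : Space d) z.1) * p.1.fst z * p.1.snd z ∂(phaseMeasure D) =
      ∫ z, (R - inner ℝ (z.2 : Space d) z.1) * φ (z.1, (z.2 : Space d)) *
        fderiv ℝ φ (z.1, (z.2 : Space d)) ((z.2 : Space d), 0) ∂(phaseMeasure D) := by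
    refine integral_congr_ae ?_
    filter_upwards [h1, h2] with x hx hx'
    rw [hx, hx']
  have i1 : Integrable (fun z : Space d × Directions d => φ (z.1, (z.2 : Space d)) ^ 2)
      (phaseMeasure D) :=
    integrable_phase_of_subset_closedBall hopen hR ((continuous_phase hφ).pow 2)
  have i2 : Integrable (fun z : Space d × Directions d =>
      (R - inner ℝ (z.2 : Space d) z.1) * φ (z.1, (z.2 : Space d)) *
        fderiv ℝ φ (z.1, (z.2 : Space d)) ((z.2 : Space d), 0)) (phaseMeasure D) :=
    integrable_phase_of_subset_closedBall hopen hR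
      (((by fun_prop : Continuous fun z : Space d × Directions d =>
        R - inner ℝ (z.2 : Space d) z.1).mul (continuous_phase hφ)).mul
          (continuous_phase_fderiv hφ))
  rw [e1, e2, integral_prod_symm _ i1, integral_prod_symm _ i2, ← integral_const_mul]
  refine integral_mono i1.integral_prod_right (i2.integral_prod_right.const_mul 2) fun s => ?_
  have := integral_sq_le_of_fiberInflow hopen hconv hR s (contDiff_slice hφ s)
    (fun x hx => hzero (x, s) hx)
  simpa only [fderiv_slice hφ] using this

end

end Transport
-- The fiber and lifted problems
theorem mainTheorem8 (d : ℕ) (hd : 1 ≤ d) (D : Set (Transport.Space d))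
    (hopen : IsOpen D) (hne : D.Nonempty) (hconv : Convex ℝ D) (hbdd : Bornology.IsBounded D)
    (σ : Transport.Space d × Transport.Directions d → ℝ) (σmax : ℝ)
    (hσm : MeasureTheory.AEStronglyMeasurable σ (Transport.phaseMeasure D))
    (hσ : ∀ᵐ z ∂(Transport.phaseMeasure D), 0 ≤ σ z ∧ σ z ≤ σmax) :
    ∃ C : ℝ,
      (∀ s : Transport.Directions d,
        MeasureTheory.AEStronglyMeasurable (fun x => σ (x, s)) (Transport.domainMeasure D) →
        (∀ᵐ x ∂(Transport.domainMeasure D), 0 ≤ σ (x, s) ∧ σ (x, s) ≤ σmax) →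
        ∀ f : Transport.L2Domain D,
          (∃! u : Transport.fiberTrial D s,
            ∀ v : Transport.L2Domain D, Transport.fiberForm D σ s u v = inner ℝ v f) ∧
          ∀ u : Transport.fiberTrial D s,
            (∀ v : Transport.L2Domain D, Transport.fiberForm D σ s u v = inner ℝ v f) →
              ‖u‖ ≤ C * ‖f‖) ∧
      (∀ f : Transport.L2Phase D,
        (∃! u : Transport.phaseTrial D,
          ∀ v : Transport.L2Phase D, Transport.phaseForm D σ u v = inner ℝ v f) ∧
        ∀ u : Transport.phaseTrial D,
          (∀ v : Transport.L2Phase D, Transport.phaseForm D σ u v = inner ℝ v f) →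
            ‖u‖ ≤ C * ‖f‖) := by
  obtain ⟨R, hR⟩ := hbdd.subset_closedBall 0
  have hR0 : 0 ≤ R := by
    obtain ⟨x, hx⟩ := hne
    exact (norm_nonneg x).trans (mem_closedBall_zero_iff.1 (hR hx))
  have hfin := Transport.isFiniteMeasure_domainMeasure hbdd
  have hw : ∀ x ∈ D, ∀ s : Transport.Directions d,
      0 ≤ R - inner ℝ (s : Transport.Space d) x ∧ R - inner ℝ (s : Transport.Space d) x ≤ 2 * R := by
    intro x hx s
    have h1 := abs_real_inner_le_norm (s : Transport.Space d) x
    rw [Transport.Directions.norm_eq, one_mul] at h1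
    have h2 := abs_le.1 (h1.trans (mem_closedBall_zero_iff.1 (hR hx)))
    constructor <;> linarith [h2.1, h2.2]
  -- The weight is bounded by `2 * R` and `σ` by `|σmax|`; the absolute value provides a
  -- non-negative bound without determining the sign of `σmax`. The constant thus depends only on
  -- `R` and `σmax`.
  refine ⟨1 + (1 + |σmax|) * (2 * (2 * R)), fun s hsm hs f => ?_, fun f => ?_⟩
  · exact Transport.wellPosed_of_energy (Transport.isClosed_fiberSpace D s)
      (Transport.fiberC1 D s) (w := fun x => R - inner ℝ (s : Transport.Space d) x)
      (abs_nonneg σmax) (by positivity) hsm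
      (hs.mono fun x hx => ⟨hx.1, hx.2.trans (le_abs_self _)⟩)
      (by fun_prop : Continuous fun x : Transport.Space d =>
        R - inner ℝ (s : Transport.Space d) x).aestronglyMeasurable
      ((MeasureTheory.ae_restrict_mem hopen.measurableSet).mono fun x hx => hw x hx s)
      (fun p hp => Transport.energy_fiberC1 hopen hconv hR s hp)
      (Transport.eq_zero_of_orthogonal_fiberC1 hopen hR0 hR s) f
  · have hform : ∀ (u : Transport.phaseTrial D) (v : Transport.L2Phase D),
        Transport.phaseForm D σ u v =
          ∫ z, (u.1.1.snd z + σ z * u.1.1.fst z) * v z ∂(Transport.phaseMeasure D) := by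
      intro u v
      -- `M` serves only to place `σ u` in `L₂`; the integrand is then integrable on the product,
      -- and Fubini identifies the iterated form with one integral.
      obtain ⟨M, hM, -⟩ := Transport.exists_mulOperator hσm
        (hσ.mono fun x hx => abs_le.2 ⟨by linarith [hx.1], hx.2⟩)
      have hint : MeasureTheory.Integrable
          (fun z => (u.1.1.snd z + σ z * u.1.1.fst z) * v z) (Transport.phaseMeasure D) := by
        refine MeasureTheory.MemLp.integrable_mul (p := 2) (q := 2)
          (f := fun z => u.1.1.snd z + σ z * u.1.1.fst z) ?_ (MeasureTheory.Lp.memLp v)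
        exact (MeasureTheory.Lp.memLp u.1.1.snd).add
          ((MeasureTheory.Lp.memLp (M u.1.1.fst)).ae_eq (hM _))
      rw [MeasureTheory.integral_prod_symm _ hint]
      rfl
    simp only [hform]
    exact Transport.wellPosed_of_energy (Transport.isClosed_phaseSpace D)
      (Transport.phaseC1 D)
      (w := fun z => R - inner ℝ (z.2 : Transport.Space d) z.1)
      (abs_nonneg σmax) (by positivity) hσm
      (hσ.mono fun x hx => ⟨hx.1, hx.2.trans (le_abs_self _)⟩)
      (by fun_prop : Continuous fun z : Transport.Space d × Transport.Directions d =>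
        R - inner ℝ (z.2 : Transport.Space d) z.1).aestronglyMeasurable
      ((Transport.ae_phaseMeasure_mem hopen).mono fun z hz => hw z.1 hz z.2)
      (fun p hp => Transport.energy_phaseC1 hopen hconv hR hp)
      (Transport.eq_zero_of_orthogonal_phaseC1 hopen hR0 hR) f
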